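/- **Theorem 1.4 (intersection LLL).** Let $X_1,\dots,X_n$ be mutually independent random variables and let $A_1,\dots,A_m$ be events such that $A_i$ is determined by the variables in $\mathrm{vbl}(A_i)\subseteq\{X_1,\dots,X_n\}$; put $p_i=\Pr(A_i)$. Let $G_D=([m],E_D)$ be the canonical dependency graph, in which $i\ne i'$ are adjacent iff $\mathrm{vbl}(A_i)\cap\mathrm{vbl}(A_{i'})\neq\emptyset$ (or, more generally, any graph on $[m]$ containing it). Let $\mathcal M\subseteq E_D$ be a matching of $G_D$, and for each $\{i,i'\}\in\mathcal M$ let $\delta_{i,i'}\in(0,1)$ satisfy $\Pr(A_i\cap A_{i'})\ge\delta_{i,i'}$. Define $$p_i^-=\begin{cases}p_i-\frac1{17}\delta_{i,i'}^2 & \text{if }\{i,i'\}\in\mathcal M\text{ for some }i',\\ p_i&\text{otherwise.}\end{cases}$$ A vector $\vec q=(q_1,\dots,q_m)$ is in Shearer's bound of $G_D$ if for every independent set $I$ of $G_D$ $$\sum_{J\supseteq I,\ J\text{ independent in }G_D}(-1)^{|J|-|I|}\prod_{i\in J}q_i>0 .$$ The Moser–Tardos algorithm draws values of $X_1,\dots,X_n$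 independently from their laws and, while some $A_i$ holds, selects one such $i$ by an arbitrary rule and resamples all variables in $\mathrm{vbl}(A_i)$ with fresh independent samples. If $\varepsilon>0$ and $(1+\varepsilon)\vec p^-$ is in Shearer's bound of $G_D$, then, for every selection rule, the expected number of resampling steps performed by the Moser–Tardos algorithm is at most $m/\varepsilon$. -/

import Mathlib

open MeasureTheory ProbabilityTheory
open scoped ENNReal

/-- The canonical dependency graph of events with variable sets `vbl i`: two distinct events are
adjacent iff they share a variable. -/
def canonicalDependencyGraph {m n : ℕ} (vbl : Fin m → Finset (Fin n)) : SimpleGraph (Fin m) where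
  Adj i i' := i ≠ i' ∧ (vbl i ∩ vbl i').Nonempty
  symm := ⟨fun _ _ h => ⟨h.1.symm, by rw [Finset.inter_comm]; exact h.2⟩⟩
  loopless := ⟨fun _ h => h.1 rfl⟩

open Classical in
/-- The quantity `q_I(G, p) = ∑_{J ∈ Ind(G), I ⊆ J} (-1)^(|J| - |I|) ∏_{i ∈ J} p_i`. -/
noncomputable def shearerQ {m : ℕ} (G : SimpleGraph (Fin m)) (p : Fin m → ℝ)
    (I : Finset (Fin m)) : ℝ :=
  ∑ J ∈ Finset.univ.filter
      (fun J : Finset (Fin m) => G.IsIndepSet (J : Set (Fin m)) ∧ I ⊆ J),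
    (-1 : ℝ) ^ (J.card - I.card) * ∏ i ∈ J, p i

/-- `p` is in Shearer's bound of `G`: `q_I(G, p) > 0` for every independent set `I`.
By Möbius inversion this already forces `0 < p i < 1` for all `i`. -/
def InShearerBound {m : ℕ} (G : SimpleGraph (Fin m)) (p : Fin m → ℝ) : Prop :=
  ∀ I : Finset (Fin m), G.IsIndepSet (I : Set (Fin m)) → 0 < shearerQ G p I

open Classical in
/-- The reduced vector `p⁻`: `p_i - δ_{i,i'}² / 17` if `i` is matched to `i'` by `M`, and `p_i` if
`i` is unmatched. -/
noncomputable def pMinus {m : ℕ} {G : SimpleGraph (Fin m)} (M : G.Subgraph)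
    (δ : Sym2 (Fin m) → ℝ) (p : Fin m → ℝ) (i : Fin m) : ℝ :=
  if h : ∃ i', M.Adj i i' then p i - δ s(i, h.choose) ^ 2 / 17 else p i

open Classical in
/-- The assignment after `t` rounds of a run which uses the samples `x j 0, x j 1, …` for the
variable `j`, in this order, and which in round `k` resamples the variables of the event `i` if
`s k = some i`, and does nothing if `s k = none`: the value of `j` is its sample number
`#{k < t | round k resampled j}`. -/
noncomputable def mtState {m n : ℕ} {α : Fin n → Type*} (vbl : Fin m → Finset (Fin n))
    (x : ∀ j, ℕ → α j) (s : ℕ → Option (Fin m)) (t : ℕ) : ∀ j, α j :=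
  fun j => x j ((Finset.range t).filter (fun k => ∃ i, s k = some i ∧ j ∈ vbl i)).card

/-- A run, on the probability space `(Ω, P)`, of the Moser–Tardos algorithm for the events `A i`
with variable sets `vbl i`, where variable `j` has law `μ j`.

`sample j k` is the `k`-th value drawn for variable `j` (`k = 0`: the initial value); all these
draws are independent. In round `t` the algorithm picks an event that holds under the current
assignment and resamples its variables, or picks `none` (it has stopped) if no event holds.
The choice among the events that hold is arbitrary: it may depend on the history of the run, on
further randomness, or on anything else in `ω`. -/
structure MoserTardosRun {m n : ℕ} {α : Fin n → Type*} [∀ j, MeasurableSpace (α j)]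
    (μ : ∀ j, Measure (α j)) (vbl : Fin m → Finset (Fin n)) (A : Fin m → Set (∀ j, α j))
    {Ω : Type*} [MeasurableSpace Ω] (P : Measure Ω) where
  sample : ∀ j, ℕ → Ω → α j
  measurable_sample : ∀ j k, Measurable (sample j k)
  map_sample : ∀ j k, P.map (sample j k) = μ j
  indep_sample : iIndepFun (β := fun q : Fin n × ℕ => α q.1) (fun q => sample q.1 q.2) P
  pick : ℕ → Ω → Option (Fin m)
  measurable_pick : ∀ t o, MeasurableSet {ω | pick t ω = o}
  holds_of_pick_eq_some : ∀ t ω i, pick t ω = some i →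
    mtState vbl (fun j k => sample j k ω) (fun k => pick k ω) t ∈ A i
  not_holds_of_pick_eq_none : ∀ t ω, pick t ω = none →
    ∀ i, mtState vbl (fun j k => sample j k ω) (fun k => pick k ω) t ∉ A i

/-- The total number `T ∈ ℕ ∪ {∞}` of resampling steps of a run. -/
noncomputable def MoserTardosRun.steps {m n : ℕ} {α : Fin n → Type*}
    [∀ j, MeasurableSpace (α j)] {μ : ∀ j, Measure (α j)} {vbl : Fin m → Finset (Fin n)}
    {A : Fin m → Set (∀ j, α j)} {Ω : Type*} [MeasurableSpace Ω] {P : Measure Ω}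
    (R : MoserTardosRun μ vbl A P) (ω : Ω) : ℕ∞ :=
  {t : ℕ | R.pick t ω ≠ none}.encard

/-!
The proof bounds the run by witnesses read off the table of samples, so that the selection rule
plays no role, and then sums the probabilities of the witnesses.

**Witnesses.** A witness is a list of independent sets of `G` ("layers"), the first one a singleton,
to be resampled from the last layer to the first one. It *passes* on the table of samples if every
event in it holds just before it is resampled. The history of a run up to the `k`-th resampling of
`A i` is a passing list that starts with `{i}` and contains `i` exactly `k` times. Among all lists
with these properties take one of minimal size plus number of inversions, then of minimal depth
(`exists_isLayered_noSwap`). Here one endpoint `a ∈ Z` of each matched edge `{a, π a}` is singled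
out, and an inversion is a resampling of `a` after one of `π a`. In a minimal list each
layer lies in the closed neighbourhood of the one before it (`LayerStep`), and whenever `a` is in a
layer and `π a` in the next one, the two resamplings do *not* pass when their order is exchanged.
As the pair `(i, k)` can be read off the list, the number of steps is at most the number of such
lists (`encard_steps_le`).

**Probabilities.** Different vertices of a list read different entries of the table. A pair `π a`,
`a` in consecutive layers passes with probability `p a * p (π a)`, and passes in both orders with
probability at least `δ ^ 2` by the Cauchy–Schwarz inequality, given the variables that the two
events do not share (`sq_measure_le_prod_mix`). So a list has probability at most its weight
`∏ p`, where each such pair brings in a factor `1 - θ a`, `θ a = δ ^ 2 / (p a * p (π a))`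
(`measureReal_goodEvent_le`).

**Summation.** Without the penalties the recursion over the layers is solved by
`q_I / q_∅` for a vector in Shearer's bound. In the recursion, the partner `π a` occurs in the layer
after `a` with weight at least `z (π a)`, so the penalty gains a factor `1 - θ a * z (π a)`
(`prod_mul_sum_pairPenalty_le`). For `z (π a) = p (π a)` this factor turns `p a` into
`p a - δ ^ 2`. Hence the total weight is at most `∑ q_{i} / q_∅`, evaluated at the vector `z`
equal to `p a - 2 * δ ^ 2 / 17` at `a ∈ Z` and to `p` elsewhere, and this is at most `m / ε` if
`(1 + ε) z` is in Shearer's bound.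

**Choice of `Z`.** The vector `z` arises from `p⁻` by moving `δ ^ 2 / 17` from `a` to `π a` for each
matched edge. As the endpoints are adjacent, the independence polynomial is affine in this
direction, and with the other coordinates fixed it decides membership in Shearer's bound, by
log-submodularity. So for each edge one of the two directions stays within Shearer's bound
(`ShearerPos.exchange`, `ShearerPos.exists_orientation`).
-/

/-! ### Independence polynomials and Shearer's bound -/

section Shearer

open scoped Classical

variable {m : ℕ} {G : SimpleGraph (Fin m)} {p q : Fin m → ℝ}

/-- The signed independence polynomial `∑_J ∏_{i ∈ J} (-p i)` of the subgraph induced on `S`, where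
`J` runs over the independent subsets of `S`. -/
noncomputable def indepPoly (G : SimpleGraph (Fin m)) (S : Finset (Fin m)) (p : Fin m → ℝ) : ℝ :=
  ∑ J ∈ S.powerset.filter (fun J : Finset (Fin m) => G.IsIndepSet (J : Set (Fin m))),
    ∏ i ∈ J, (-p i)

/-- The closed neighbourhood of a set of vertices. -/
noncomputable def closedNbhd (G : SimpleGraph (Fin m)) (I : Finset (Fin m)) : Finset (Fin m) :=
  Finset.univ.filter (fun v => v ∈ I ∨ ∃ i ∈ I, G.Adj i v)

/-- Nonnegative vectors for which every induced subgraph has positive independence polynomial.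
Up to vanishing coordinates this is Shearer's bound. -/
def ShearerPos (G : SimpleGraph (Fin m)) (p : Fin m → ℝ) : Prop :=
  (∀ i, 0 ≤ p i) ∧ ∀ S, 0 < indepPoly G S p

theorem indepPoly_congr {S : Finset (Fin m)} (h : ∀ i ∈ S, p i = q i) :
    indepPoly G S p = indepPoly G S q := by
  refine Finset.sum_congr rfl fun J hJ => Finset.prod_congr rfl fun i hi => ?_
  rw [h i (Finset.mem_powerset.1 (Finset.mem_filter.1 hJ).1 hi)]

@[simp] theorem indepPoly_empty : indepPoly G ∅ p = 1 := by
  have : G.IsIndepSet (∅ : Set (Fin m)) := by simp [SimpleGraph.IsIndepSet]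
  simp [indepPoly, Finset.filter_singleton, this]

theorem isIndepSet_insert_iff {v : Fin m} {J : Finset (Fin m)} (hv : v ∉ J) :
    G.IsIndepSet (insert v J : Finset (Fin m)) ↔
      G.IsIndepSet (J : Set (Fin m)) ∧ ∀ j ∈ J, ¬ G.Adj v j := by
  rw [Finset.coe_insert, SimpleGraph.IsIndepSet, Set.pairwise_insert]
  constructor
  · rintro ⟨h1, h2⟩
    exact ⟨h1, fun j hj => (h2 j hj (fun h => hv (h ▸ hj))).1⟩
  · rintro ⟨h1, h2⟩
    exact ⟨h1, fun j hj _ => ⟨h2 j hj, fun h => h2 j hj h.symm⟩⟩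

theorem indepPoly_insert {v : Fin m} {S : Finset (Fin m)} (hv : v ∉ S) :
    indepPoly G (insert v S) p
      = indepPoly G S p - p v * indepPoly G (S.filter (fun j => ¬ G.Adj v j)) p := by
  have hdisj : Disjoint
      (S.powerset.filter (fun J : Finset (Fin m) => G.IsIndepSet (J : Set (Fin m))))
      ((S.powerset.image (insert v)).filter
        (fun J : Finset (Fin m) => G.IsIndepSet (J : Set (Fin m)))) := by
    rw [Finset.disjoint_left]
    intro J h1 h2
    obtain ⟨K, _, rfl⟩ := Finset.mem_image.1 (Finset.mem_filter.1 h2).1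
    exact hv (Finset.mem_powerset.1 (Finset.mem_filter.1 h1).1 (Finset.mem_insert_self v K))
  have himg : (S.powerset.image (insert v)).filter
        (fun J : Finset (Fin m) => G.IsIndepSet (J : Set (Fin m)))
      = ((S.filter (fun j => ¬ G.Adj v j)).powerset.filter
          (fun J : Finset (Fin m) => G.IsIndepSet (J : Set (Fin m)))).image (insert v) := by
    ext J
    simp only [Finset.mem_filter, Finset.mem_image, Finset.mem_powerset]
    constructor
    · rintro ⟨⟨K, hK, rfl⟩, hJ⟩
      have hvK : v ∉ K := fun h => hv (hK h)
      rw [isIndepSet_insert_iff hvK] at hJ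
      exact ⟨K, ⟨fun j hj => Finset.mem_filter.2 ⟨hK hj, hJ.2 j hj⟩, hJ.1⟩, rfl⟩
    · rintro ⟨K, ⟨hK, hKi⟩, rfl⟩
      have hvK : v ∉ K := fun h => hv (Finset.mem_filter.1 (hK h)).1
      exact ⟨⟨K, fun j hj => (Finset.mem_filter.1 (hK hj)).1, rfl⟩,
        (isIndepSet_insert_iff hvK).2 ⟨hKi, fun j hj => (Finset.mem_filter.1 (hK hj)).2⟩⟩
  have hinj : Set.InjOn (insert v) (((S.filter (fun j => ¬ G.Adj v j)).powerset.filter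
      (fun J : Finset (Fin m) => G.IsIndepSet (J : Set (Fin m))) : Finset (Finset (Fin m))) :
      Set (Finset (Fin m))) := by
    intro K hK K' hK' h
    have hvK : ∀ K ∈ ((S.filter (fun j => ¬ G.Adj v j)).powerset.filter
        (fun J : Finset (Fin m) => G.IsIndepSet (J : Set (Fin m)))), v ∉ K := fun K hK h =>
      hv (Finset.mem_filter.1 (Finset.mem_powerset.1 (Finset.mem_filter.1 hK).1 h)).1
    rw [← Finset.erase_insert (hvK K hK), ← Finset.erase_insert (hvK K' hK')]
    exact congrArg (fun T => Finset.erase T v) h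
  unfold indepPoly
  rw [Finset.powerset_insert, Finset.filter_union, Finset.sum_union hdisj, himg,
    Finset.sum_image hinj, Finset.mul_sum, sub_eq_add_neg, ← Finset.sum_neg_distrib]
  congr 1
  refine Finset.sum_congr rfl fun K hK => ?_
  have hvK : v ∉ K := fun h =>
    hv (Finset.mem_filter.1 (Finset.mem_powerset.1 (Finset.mem_filter.1 hK).1 h)).1
  rw [Finset.prod_insert hvK]
  ring

theorem indepPoly_anti {V S T : Finset (Fin m)} (hp : ∀ i, 0 ≤ p i)
    (hV : ∀ T ⊆ V, 0 < indepPoly G T p) (hST : S ⊆ T) (hT : T ⊆ V) :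
    indepPoly G T p ≤ indepPoly G S p := by
  obtain ⟨D, rfl⟩ : ∃ D, T = D ∪ S := ⟨T, (Finset.union_eq_left.2 hST).symm⟩
  clear hST
  induction D using Finset.induction_on with
  | empty => simp
  | insert v D hv ih =>
    rw [Finset.insert_union] at hT ⊢
    have hsub : D ∪ S ⊆ V := (Finset.subset_insert _ _).trans hT
    by_cases hvS : v ∈ D ∪ S
    · rw [Finset.insert_eq_of_mem hvS]; exact ih hsub
    · rw [indepPoly_insert hvS]
      have := hV _ ((Finset.filter_subset (fun j => ¬ G.Adj v j) (D ∪ S)).trans hsub)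
      nlinarith [ih hsub, mul_nonneg (hp v) this.le]

/-- Log-submodularity of `S ↦ indepPoly G S p`: deleting vertices increases the conditional weight
of every other set of vertices. -/
theorem indepPoly_inter_mul_union_le {V : Finset (Fin m)} (hp : ∀ i, 0 ≤ p i)
    (hV : ∀ T ⊆ V, 0 < indepPoly G T p) (A B : Finset (Fin m)) (hAB : A ∪ B ⊆ V) :
    indepPoly G (A ∩ B) p * indepPoly G (A ∪ B) p ≤ indepPoly G A p * indepPoly G B p := by
  obtain ⟨n, hn⟩ : ∃ n, (A ∪ B).card ≤ n := ⟨_, le_rfl⟩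
  induction n generalizing A B with
  | zero =>
    have h := Finset.card_eq_zero.1 (Nat.le_zero.1 hn)
    obtain ⟨rfl, rfl⟩ := Finset.union_eq_empty.1 h
    simp
  | succ n ih =>
    by_cases hsub : A ⊆ B
    · rw [Finset.inter_eq_left.2 hsub, Finset.union_eq_right.2 hsub]
    obtain ⟨v, hvA, hvB⟩ := Finset.not_subset.1 hsub
    obtain ⟨A', hvA', rfl⟩ : ∃ A', v ∉ A' ∧ A = insert v A' :=
      ⟨A.erase v, Finset.notMem_erase _ _, (Finset.insert_erase hvA).symm⟩
    have hvU : v ∉ A' ∪ B := by simp [hvA', hvB]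
    rw [Finset.insert_union] at hn hAB ⊢
    rw [Finset.insert_inter_of_notMem hvB, indepPoly_insert hvU, indepPoly_insert hvA']
    have hsubU : A' ∪ B ⊆ V := (Finset.subset_insert _ _).trans hAB
    have hcard : (A' ∪ B).card ≤ n := by
      rw [Finset.card_insert_of_notMem hvU] at hn; omega
    have ih1 := ih A' B hsubU hcard
    set N : Finset (Fin m) → Finset (Fin m) := fun S => S.filter (fun j => ¬ G.Adj v j) with hN
    have hXY : A' ∪ N (A' ∪ B) ⊆ A' ∪ B :=
      Finset.union_subset Finset.subset_union_left (Finset.filter_subset _ _)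
    have ih2 := ih A' (N (A' ∪ B)) (hXY.trans hsubU)
      ((Finset.card_le_card hXY).trans hcard)
    have hi : A' ∩ N (A' ∪ B) = N A' := by
      ext x; simp only [hN, Finset.mem_inter, Finset.mem_filter, Finset.mem_union]; tauto
    rw [hi] at ih2
    have h3 := indepPoly_anti hp hV hXY hsubU
    have ha := hV A' (Finset.subset_union_left.trans hsubU)
    have hc := hV (A' ∩ B) ((Finset.inter_subset_left.trans Finset.subset_union_left).trans hsubU)
    have he := hV (N A') (((Finset.filter_subset _ _).trans Finset.subset_union_left).trans hsubU)
    have hA := hV (insert v A') (Finset.insert_subset_iff.2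
      ⟨hAB (Finset.mem_insert_self _ _), Finset.subset_union_left.trans hsubU⟩)
    rw [indepPoly_insert hvA'] at hA
    change 0 < indepPoly G A' p - p v * indepPoly G (N A') p at hA
    change indepPoly G (A' ∩ B) p * (indepPoly G (A' ∪ B) p - p v * indepPoly G (N (A' ∪ B)) p)
      ≤ (indepPoly G A' p - p v * indepPoly G (N A') p) * indepPoly G B p
    generalize indepPoly G A' p = a at *
    generalize indepPoly G (A' ∪ B) p = b at *
    generalize indepPoly G (A' ∩ B) p = c at *
    generalize indepPoly G B p = d at *
    generalize indepPoly G (N A') p = e at *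
    generalize indepPoly G (N (A' ∪ B)) p = f at *
    have h4 : e * b ≤ a * f := (mul_le_mul_of_nonneg_left h3 he.le).trans ih2
    refine le_of_mul_le_mul_left ?_ ha
    have h5 : c * (p v * (e * b)) ≤ c * (p v * (a * f)) := by
      gcongr
      exact hp v
    nlinarith [mul_le_mul_of_nonneg_right ih1 hA.le]

theorem indepPoly_union_le (hp : ShearerPos G p) {S B : Finset (Fin m)} (hSB : Disjoint B S) :
    indepPoly G (B ∪ S) p ≤ indepPoly G S p * ∏ b ∈ B, (1 - p b) := by
  induction B using Finset.induction_on with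
  | empty => simp
  | insert v B hv ih =>
    rw [Finset.disjoint_insert_left] at hSB
    have hvU : v ∉ B ∪ S := by simp [hv, hSB.1]
    have h1 : 0 ≤ 1 - p v := by
      have := hp.2 {v}
      rw [← insert_empty_eq, indepPoly_insert (Finset.notMem_empty v)] at this
      simp at this; linarith
    rw [Finset.insert_union, indepPoly_insert hvU, Finset.prod_insert hv]
    have h2 := indepPoly_anti hp.1 (fun T _ => hp.2 T)
      (Finset.filter_subset (fun j => ¬ G.Adj v j) (B ∪ S)) (Finset.subset_univ _)
    have h3 := mul_le_mul_of_nonneg_left h2 (hp.1 v)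
    have h4 := mul_le_mul_of_nonneg_left (ih hSB.2) h1
    linarith

/-- `indepPoly` is affine in every coordinate. -/
theorem indepPoly_update (S : Finset (Fin m)) {v : Fin m} (hv : v ∈ S) (x : ℝ) :
    indepPoly G S (Function.update p v x) = indepPoly G S p
      + (p v - x) * indepPoly G ((S.erase v).filter (fun j => ¬ G.Adj v j)) p := by
  obtain ⟨S, hvS, rfl⟩ : ∃ S', v ∉ S' ∧ S = insert v S' :=
    ⟨S.erase v, Finset.notMem_erase _ _, (Finset.insert_erase hv).symm⟩
  have h : ∀ T ⊆ S, indepPoly G T (Function.update p v x) = indepPoly G T p := fun T hT =>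
    indepPoly_congr fun i hi =>
      Function.update_of_ne (fun h => hvS (by rw [← h]; exact hT hi)) _ _
  rw [indepPoly_insert hvS, indepPoly_insert hvS, Finset.erase_insert hvS, h S le_rfl,
    h _ (Finset.filter_subset _ _), Function.update_self]
  ring

theorem ShearerPos.update (hp : ShearerPos G p) {v : Fin m} {x : ℝ} (h0 : 0 ≤ x) (hx : x ≤ p v) :
    ShearerPos G (Function.update p v x) ∧
      ∀ S, indepPoly G S p ≤ indepPoly G S (Function.update p v x) := by
  have key : ∀ S, indepPoly G S p ≤ indepPoly G S (Function.update p v x) := by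
    intro S
    by_cases hv : v ∈ S
    · rw [indepPoly_update S hv]
      nlinarith [hp.2 ((S.erase v).filter (fun j => ¬ G.Adj v j))]
    · exact (indepPoly_congr fun i hi =>
        (Function.update_of_ne (fun h => hv (by rw [← h]; exact hi)) _ _).symm).le
  refine ⟨⟨fun i => ?_, fun S => (hp.2 S).trans_le (key S)⟩, key⟩
  by_cases hi : i = v
  · subst hi; simpa using h0
  · simpa [Function.update_of_ne hi] using hp.1 i

theorem ShearerPos.mono (hp : ShearerPos G p) (h0 : ∀ i, 0 ≤ q i) (hq : ∀ i, q i ≤ p i) :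
    ShearerPos G q := by
  have key : ∀ U : Finset (Fin m), ShearerPos G (U.piecewise q p) := by
    intro U
    induction U using Finset.induction_on with
    | empty => simpa using hp
    | insert v U hv ih =>
      rw [Finset.piecewise_insert]
      refine (ih.update (h0 v) ?_).1
      simpa [Finset.piecewise_eq_of_notMem _ _ _ hv] using hq v
  simpa using key Finset.univ

theorem isIndepSet_union_iff {I K : Finset (Fin m)} (hI : G.IsIndepSet (I : Set (Fin m)))
    (hK : Disjoint K (closedNbhd G I)) :
    G.IsIndepSet ((I ∪ K : Finset (Fin m)) : Set (Fin m)) ↔ G.IsIndepSet (K : Set (Fin m)) := by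
  have hn : ∀ i ∈ I, ∀ k ∈ K, ¬ G.Adj i k := fun i hi k hk h =>
    Finset.disjoint_left.1 hK hk (by simp only [closedNbhd, Finset.mem_filter]; exact
      ⟨Finset.mem_univ _, Or.inr ⟨i, hi, h⟩⟩)
  rw [Finset.coe_union]
  constructor
  · exact fun h => h.mono Set.subset_union_right
  · intro h x hx y hy hxy
    rcases hx with hx | hx <;> rcases hy with hy | hy
    · exact hI hx hy hxy
    · exact hn x hx y hy
    · exact fun h' => hn y hy x hx h'.symm
    · exact h hx hy hxy

theorem shearerQ_eq {I : Finset (Fin m)} (hI : G.IsIndepSet (I : Set (Fin m))) :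
    shearerQ G p I = (∏ i ∈ I, p i) * indepPoly G (closedNbhd G I)ᶜ p := by
  unfold shearerQ indepPoly
  rw [Finset.mul_sum]
  have hIN : I ⊆ closedNbhd G I := fun i hi => by simp [closedNbhd, hi]
  symm
  refine Finset.sum_bij' (fun K _ => I ∪ K) (fun J _ => J \ I) ?_ ?_ ?_ ?_ ?_
  · intro K hK
    simp only [Finset.mem_filter, Finset.mem_powerset] at hK
    have hd : Disjoint K (closedNbhd G I) := by
      rw [Finset.disjoint_left]; exact fun x hx hx' => Finset.mem_compl.1 (hK.1 hx) hx'
    simp only [Finset.mem_filter, Finset.mem_univ, true_and]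
    exact ⟨(isIndepSet_union_iff hI hd).2 hK.2, Finset.subset_union_left⟩
  · intro J hJ
    simp only [Finset.mem_filter, Finset.mem_univ, true_and] at hJ
    simp only [Finset.mem_filter, Finset.mem_powerset]
    refine ⟨fun x hx => ?_, hJ.1.mono (by simp)⟩
    rw [Finset.mem_sdiff] at hx
    simp only [closedNbhd, Finset.mem_compl, Finset.mem_filter, Finset.mem_univ, true_and, not_or,
      not_exists, not_and]
    exact ⟨hx.2, fun i hi => hJ.1 (hJ.2 hi) hx.1 (fun h => hx.2 (h ▸ hi))⟩
  · intro K hK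
    simp only [Finset.mem_filter, Finset.mem_powerset] at hK
    have hd : Disjoint K I := by
      rw [Finset.disjoint_left]; exact fun x hx hx' => Finset.mem_compl.1 (hK.1 hx) (hIN hx')
    rw [Finset.union_sdiff_left, Finset.sdiff_eq_self_of_disjoint hd]
  · intro J hJ
    simp only [Finset.mem_filter, Finset.mem_univ, true_and] at hJ
    exact Finset.union_sdiff_of_subset hJ.2
  · intro K hK
    simp only [Finset.mem_filter, Finset.mem_powerset] at hK
    have hd : Disjoint I K := by
      rw [Finset.disjoint_left]; exact fun x hx hx' => Finset.mem_compl.1 (hK.1 hx') (hIN hx)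
    rw [Finset.prod_union hd, Finset.card_union_of_disjoint hd, Nat.add_sub_cancel_left,
      Finset.prod_neg]
    ring

/-- Möbius inversion with weights: summing `shearerQ` over the independent subsets of `U`, each
vertex being thinned by a factor `f i`, gives the independence polynomial with rescaled vector. -/
theorem sum_prod_mul_shearerQ (U : Finset (Fin m)) (f : Fin m → ℝ) :
    ∑ J ∈ U.powerset.filter (fun J : Finset (Fin m) => G.IsIndepSet (J : Set (Fin m))),
        (∏ i ∈ J, f i) * shearerQ G p J
      = indepPoly G Finset.univ (fun i => if i ∈ U then p i * (1 - f i) else p i) := by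
  have h1 : ∀ K : Finset (Fin m),
      ∏ i ∈ K, (-(if i ∈ U then p i * (1 - f i) else p i))
        = ∑ J ∈ (K ∩ U).powerset,
          (∏ i ∈ J, f i) * ((-1 : ℝ) ^ (K.card - J.card) * ∏ i ∈ K, p i) := by
    intro K
    have h2 : ∏ i ∈ K, (-(if i ∈ U then p i * (1 - f i) else p i))
        = (∏ i ∈ K, (-p i)) * ∏ i ∈ K ∩ U, (1 + -f i) := by
      rw [← Finset.filter_mem_eq_inter, Finset.prod_filter, ← Finset.prod_mul_distrib]
      refine Finset.prod_congr rfl fun i _ => ?_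
      split_ifs <;> ring
    rw [h2, Finset.prod_one_add, Finset.mul_sum]
    refine Finset.sum_congr rfl fun J hJ => ?_
    have hJK : J.card ≤ K.card :=
      Finset.card_le_card ((Finset.mem_powerset.1 hJ).trans Finset.inter_subset_left)
    rw [Finset.prod_neg, Finset.prod_neg]
    have h3 : (-1 : ℝ) ^ (K.card - J.card) = (-1) ^ K.card * (-1) ^ J.card := by
      conv_rhs => rw [← Nat.sub_add_cancel hJK, pow_add, mul_assoc, ← mul_pow]
      simp
    rw [h3]; ring
  unfold indepPoly shearerQ
  simp_rw [h1, Finset.mul_sum]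
  rw [Finset.sum_comm' (t' := Finset.univ.powerset.filter
    (fun J : Finset (Fin m) => G.IsIndepSet (J : Set (Fin m)))) (s' := fun K => (K ∩ U).powerset)]
  intro J K
  simp only [Finset.mem_filter, Finset.mem_powerset, Finset.mem_univ, true_and,
    Finset.subset_univ, Finset.subset_inter_iff]
  constructor
  · rintro ⟨⟨h1, _⟩, h3, h4⟩
    exact ⟨⟨h4, h1⟩, h3⟩
  · rintro ⟨⟨h4, h1⟩, h3⟩
    exact ⟨⟨h1, h3.mono (by exact_mod_cast h4)⟩, h3, h4⟩

theorem sum_shearerQ (U : Finset (Fin m)) :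
    ∑ J ∈ U.powerset.filter (fun J : Finset (Fin m) => G.IsIndepSet (J : Set (Fin m))),
        shearerQ G p J
      = indepPoly G Uᶜ p := by
  have h := sum_prod_mul_shearerQ (G := G) (p := p) U (fun _ => 1)
  simp only [Finset.prod_const_one, one_mul, sub_self, mul_zero] at h
  rw [h]
  -- Deleting vertices amounts to giving them weight zero.
  have key : ∀ V : Finset (Fin m), V ⊆ U →
      indepPoly G (V ∪ Uᶜ) (fun i => if i ∈ U then 0 else p i) = indepPoly G Uᶜ p := by
    intro V
    induction V using Finset.induction_on with
    | empty =>
      intro _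
      rw [Finset.empty_union]
      exact indepPoly_congr fun i hi => if_neg (Finset.mem_compl.1 hi)
    | insert v V hv ih =>
      intro hVU
      have hvU := hVU (Finset.mem_insert_self v V)
      rw [Finset.insert_union, indepPoly_insert (by simp [hv, hvU]), if_pos hvU, zero_mul, sub_zero]
      exact ih ((Finset.subset_insert _ _).trans hVU)
  simpa using key U le_rfl

theorem InShearerBound.pos (h : InShearerBound G p) (i : Fin m) : 0 < p i := by
  have hI : G.IsIndepSet (({i} : Finset (Fin m)) : Set (Fin m)) := by simp [SimpleGraph.IsIndepSet]
  have h1 := h {i} hI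
  have h2 : 0 < indepPoly G (closedNbhd G {i})ᶜ p := by
    rw [← sum_shearerQ]
    refine Finset.sum_pos (fun J hJ => h J (Finset.mem_filter.1 hJ).2) ⟨∅, ?_⟩
    simp [SimpleGraph.IsIndepSet]
  rw [shearerQ_eq hI, Finset.prod_singleton] at h1
  exact (pos_iff_pos_of_mul_pos h1).2 h2

theorem InShearerBound.shearerPos (h : InShearerBound G p) : ShearerPos G p := by
  refine ⟨fun i => (h.pos i).le, fun S => ?_⟩
  rw [← compl_compl S, ← sum_shearerQ]
  refine Finset.sum_pos (fun J hJ => h J (Finset.mem_filter.1 hJ).2) ⟨∅, ?_⟩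
  simp [SimpleGraph.IsIndepSet]

/-- Along an exchange of mass between two adjacent vertices the polynomial is affine, so one of the
two directions does not decrease it; and with the other coordinates fixed, Shearer's bound is
decided by the polynomial of the whole graph. -/
theorem ShearerPos.exchange (hp : ShearerPos G p) {a b : Fin m} (hab : G.Adj a b) {t : ℝ}
    (ht : 0 ≤ t) (ha : t ≤ p a) (hb : t ≤ p b) :
    ShearerPos G (Function.update (Function.update p a (p a - t)) b (p b + t)) ∨
      ShearerPos G (Function.update (Function.update p a (p a + t)) b (p b - t)) := by
  have hne : a ≠ b := hab.ne
  set V : Finset (Fin m) := (Finset.univ.erase a).erase b with hVdef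
  have haV : a ∉ V := by simp [hVdef]
  have hbV : b ∉ V := by simp [hVdef]
  have hVu : insert a (insert b V) = Finset.univ := by
    ext x; by_cases h1 : x = a <;> by_cases h2 : x = b <;> simp [hVdef, h1, h2]
  -- The polynomial of a set containing both endpoints, for a vector that agrees with `p` off them.
  have expand : ∀ (r : Fin m → ℝ), (∀ i ∈ V, r i = p i) → ∀ S ⊆ V,
      indepPoly G (insert b S) r = indepPoly G S p
        - r b * indepPoly G (S.filter (fun j => ¬ G.Adj b j)) p ∧
      indepPoly G (insert a S) r = indepPoly G S p
        - r a * indepPoly G (S.filter (fun j => ¬ G.Adj a j)) p ∧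
      indepPoly G (insert a (insert b S)) r = indepPoly G S p
        - r a * indepPoly G (S.filter (fun j => ¬ G.Adj a j)) p
        - r b * indepPoly G (S.filter (fun j => ¬ G.Adj b j)) p := by
    intro r hr S hS
    have hc : ∀ T ⊆ S, indepPoly G T r = indepPoly G T p := fun T hT =>
      indepPoly_congr fun i hi => hr i (hS (hT hi))
    have hb' : b ∉ S := fun h => hbV (hS h)
    have ha' : a ∉ S := fun h => haV (hS h)
    refine ⟨?_, ?_, ?_⟩
    · rw [indepPoly_insert hb', hc S le_rfl, hc _ (Finset.filter_subset _ _)]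
    · rw [indepPoly_insert ha', hc S le_rfl, hc _ (Finset.filter_subset _ _)]
    · rw [indepPoly_insert (by simp [hne, ha']), indepPoly_insert hb', Finset.filter_insert,
        if_neg (not_not.2 hab), hc S le_rfl, hc _ (Finset.filter_subset _ _),
        hc _ (Finset.filter_subset _ _)]
      ring
  have main : ∀ r : Fin m → ℝ, (∀ i ∈ V, r i = p i) → 0 ≤ r a → 0 ≤ r b →
      0 < indepPoly G Finset.univ r → ShearerPos G r := by
    intro r hr hra hrb hu
    have hpos : ∀ S ⊆ V, 0 < indepPoly G (insert a (insert b S)) r := by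
      intro S hS
      rw [(expand r hr S hS).2.2]
      rw [← hVu, (expand r hr V le_rfl).2.2] at hu
      have ratio : ∀ v, indepPoly G (S.filter (fun j => ¬ G.Adj v j)) p * indepPoly G V p
          ≤ indepPoly G S p * indepPoly G (V.filter (fun j => ¬ G.Adj v j)) p := by
        intro v
        have h1 := indepPoly_inter_mul_union_le (V := Finset.univ) hp.1 (fun T _ => hp.2 T) S
          (V.filter (fun j => ¬ G.Adj v j)) (Finset.subset_univ _)
        have h2 : S ∩ V.filter (fun j => ¬ G.Adj v j) = S.filter (fun j => ¬ G.Adj v j) := by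
          ext x; simp only [Finset.mem_inter, Finset.mem_filter]
          exact ⟨fun h => ⟨h.1, h.2.2⟩, fun h => ⟨h.1, hS h.1, h.2⟩⟩
        rw [h2] at h1
        refine le_trans (mul_le_mul_of_nonneg_left ?_ (hp.2 _).le) h1
        exact indepPoly_anti hp.1 (fun T _ => hp.2 T)
          (Finset.union_subset hS (Finset.filter_subset _ _)) (Finset.subset_univ _)
      refine (mul_pos_iff_of_pos_right (hp.2 V)).1 ?_
      have h3 := mul_pos (hp.2 S) hu
      have h4 := mul_le_mul_of_nonneg_left (ratio a) hra
      have h5 := mul_le_mul_of_nonneg_left (ratio b) hrb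
      nlinarith
    refine ⟨fun i => ?_, fun T => ?_⟩
    · by_cases hia : i = a
      · rw [hia]; exact hra
      by_cases hib : i = b
      · rw [hib]; exact hrb
      rw [hr i (by simp [hVdef, hia, hib])]; exact hp.1 i
    · set S := (T.erase a).erase b with hSdef
      have hS : S ⊆ V := Finset.erase_subset_erase _
        (Finset.erase_subset_erase _ (Finset.subset_univ _))
      have h1 := hpos S hS
      have h2 := expand r hr S hS
      have hna := mul_nonneg hra (hp.2 (S.filter (fun j => ¬ G.Adj a j))).le
      have hnb := mul_nonneg hrb (hp.2 (S.filter (fun j => ¬ G.Adj b j))).le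
      by_cases hTa : a ∈ T <;> by_cases hTb : b ∈ T
      · have : T = insert a (insert b S) := by
          ext x; by_cases e1 : x = a <;> by_cases e2 : x = b <;> simp [hSdef, e1, e2, hTa, hTb]
        rwa [this]
      · have : T = insert a S := by
          ext x; by_cases e1 : x = a <;> by_cases e2 : x = b <;>
            simp [hSdef, e1, e2, hTa, hTb, hne.symm]
        rw [this]; linarith
      · have : T = insert b S := by
          ext x; by_cases e1 : x = a <;> by_cases e2 : x = b <;>
            simp [hSdef, e1, e2, hTa, hTb]
        rw [this]; linarith
      · have : T = S := by
          rw [hSdef, Finset.erase_eq_of_notMem hTa, Finset.erase_eq_of_notMem hTb]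
        rw [this, indepPoly_congr (q := p) (fun i hi => hr i (hS hi))]; exact hp.2 _
  have hV' : ∀ x y : ℝ, ∀ i ∈ V, Function.update (Function.update p a x) b y i = p i := by
    intro x y i hi
    rw [Function.update_of_ne (by rintro rfl; exact hbV hi),
      Function.update_of_ne (by rintro rfl; exact haV hi)]
  have ea : ∀ x y : ℝ, Function.update (Function.update p a x) b y a = x := fun x y => by
    rw [Function.update_of_ne hne, Function.update_self]
  have eb : ∀ x y : ℝ, Function.update (Function.update p a x) b y b = y := fun x y => by
    rw [Function.update_self]
  have h0 := hp.2 Finset.univ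
  rw [← hVu, (expand p (fun _ _ => rfl) V le_rfl).2.2] at h0
  have h1 := (expand _ (hV' (p a - t) (p b + t)) V le_rfl).2.2
  have h2 := (expand _ (hV' (p a + t) (p b - t)) V le_rfl).2.2
  rw [hVu, ea, eb] at h1 h2
  by_cases hpos : 0 < indepPoly G Finset.univ
      (Function.update (Function.update p a (p a - t)) b (p b + t))
  · left
    refine main _ (hV' _ _) ?_ ?_ hpos
    · rw [ea]; linarith
    · rw [eb]; linarith
  · right
    refine main _ (hV' _ _) ?_ ?_ ?_
    · rw [ea]; linarith
    · rw [eb]; linarith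
    · rw [h2]; rw [h1] at hpos; linarith

theorem shearerQ_singleton_div_le {ε : ℝ} (hε : 0 < ε)
    (hp : ShearerPos G (fun i => (1 + ε) * p i)) (hp0 : ∀ i, 0 ≤ p i) (i : Fin m) :
    shearerQ G p {i} / indepPoly G Finset.univ p ≤ 1 / ε := by
  have hle : ∀ j, p j ≤ (1 + ε) * p j := fun j => by nlinarith [hp0 j]
  have hpp : ShearerPos G p := hp.mono hp0 hle
  have hu : ShearerPos G (Function.update p i ((1 + ε) * p i)) := by
    refine hp.mono (fun j => ?_) (fun j => ?_) <;> by_cases hj : j = i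
    · subst hj; simpa using mul_nonneg (by linarith) (hp0 j)
    · simpa [Function.update_of_ne hj] using hp0 j
    · subst hj; simp
    · simpa [Function.update_of_ne hj] using hle j
  have h1 := hu.2 Finset.univ
  rw [indepPoly_update _ (Finset.mem_univ i)] at h1
  have hI : G.IsIndepSet (({i} : Finset (Fin m)) : Set (Fin m)) := by simp [SimpleGraph.IsIndepSet]
  have h2 : (Finset.univ.erase i).filter (fun j => ¬ G.Adj i j) = (closedNbhd G {i})ᶜ := by
    ext x; simp [closedNbhd]
  rw [h2] at h1
  rw [shearerQ_eq hI, Finset.prod_singleton, div_le_div_iff₀ (hpp.2 _) hε]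
  linarith

end Shearer

/-! ### Weights of layered lists -/

section Layers

open scoped Classical

variable {m : ℕ} {G : SimpleGraph (Fin m)} {p z : Fin m → ℝ} {Z : Finset (Fin m)}
  {π : Fin m → Fin m} {θ : Fin m → ℝ}

/-- The factor `∏ (1 - θ a)` over those `a ∈ I ∩ Z` whose partner `π a` lies in the next layer
`J`. -/
noncomputable def pairPenalty (Z : Finset (Fin m)) (π : Fin m → Fin m) (θ : Fin m → ℝ)
    (I J : Finset (Fin m)) : ℝ :=
  ∏ a ∈ I.filter (fun a => a ∈ Z ∧ π a ∈ J), (1 - θ a)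

/-- The weight of a list of layers: the product of `p` over all its vertices, with a penalty
`1 - θ a` for every pair `a`, `π a` in consecutive layers. -/
noncomputable def layerWeight (p : Fin m → ℝ) (Z : Finset (Fin m)) (π : Fin m → Fin m)
    (θ : Fin m → ℝ) : List (Finset (Fin m)) → ℝ
  | [] => 1
  | I :: L => (∏ i ∈ I, p i) * pairPenalty Z π θ I (L.headD ∅) * layerWeight p Z π θ L

/-- `J` may follow `I` in a layered list: `J` is a nonempty independent set, each vertex of which
is in `I` or adjacent to a vertex of `I`. -/
def LayerStep (G : SimpleGraph (Fin m)) (I J : Finset (Fin m)) : Prop :=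
  J.Nonempty ∧ G.IsIndepSet (J : Set (Fin m)) ∧ J ⊆ closedNbhd G I

/-- The lists of at most `n + 1` layers that start with `I` and satisfy `LayerStep`. -/
noncomputable def layeredLists (G : SimpleGraph (Fin m)) :
    ℕ → Finset (Fin m) → Finset (List (Finset (Fin m)))
  | 0, I => {[I]}
  | n + 1, I => insert [I] ((Finset.univ.filter (LayerStep G I)).biUnion
      fun J => (layeredLists G n J).image (List.cons I))

/-- Layered lists whose first layer is a singleton. -/
def IsLayered (G : SimpleGraph (Fin m)) (L : List (Finset (Fin m))) : Prop :=
  ∃ i L', L = {i} :: L' ∧ List.IsChain (LayerStep G) L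

theorem exists_cons_of_mem_layeredLists {n : ℕ} {I : Finset (Fin m)} {L : List (Finset (Fin m))}
    (h : L ∈ layeredLists G n I) : ∃ L', L = I :: L' := by
  cases n with
  | zero => exact ⟨[], by simpa [layeredLists] using h⟩
  | succ n =>
    simp only [layeredLists, Finset.mem_insert, Finset.mem_biUnion, Finset.mem_image] at h
    rcases h with h | ⟨J, _, L', _, rfl⟩
    · exact ⟨[], h⟩
    · exact ⟨L', rfl⟩

theorem mem_layeredLists {n : ℕ} {I : Finset (Fin m)} {L : List (Finset (Fin m))}
    (h : List.IsChain (LayerStep G) (I :: L)) (hn : L.length ≤ n) :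
    I :: L ∈ layeredLists G n I := by
  induction n generalizing I L with
  | zero =>
    rw [List.length_eq_zero_iff.1 (Nat.le_zero.1 hn)]
    simp [layeredLists]
  | succ n ih =>
    cases L with
    | nil => simp [layeredLists]
    | cons J L =>
      rw [List.isChain_cons_cons] at h
      simp only [layeredLists, Finset.mem_insert, Finset.mem_biUnion, Finset.mem_image]
      exact Or.inr ⟨J, by simpa using h.1, J :: L, ih h.2 (by simpa using hn), rfl⟩

theorem pairPenalty_nonneg (hθ1 : ∀ a ∈ Z, θ a ≤ 1) (I J : Finset (Fin m)) :
    0 ≤ pairPenalty Z π θ I J :=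
  Finset.prod_nonneg fun a ha => sub_nonneg.2 (hθ1 a (Finset.mem_filter.1 ha).2.1)

theorem layerWeight_nonneg (hp : ∀ i, 0 ≤ p i) (hθ1 : ∀ a ∈ Z, θ a ≤ 1)
    (L : List (Finset (Fin m))) : 0 ≤ layerWeight p Z π θ L := by
  induction L with
  | nil => exact zero_le_one
  | cons I L ih =>
    exact mul_nonneg
      (mul_nonneg (Finset.prod_nonneg fun i _ => hp i) (pairPenalty_nonneg hθ1 _ _)) ih

theorem ShearerPos.shearerQ_nonneg (hz : ShearerPos G z) {I : Finset (Fin m)}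
    (hI : G.IsIndepSet (I : Set (Fin m))) : 0 ≤ shearerQ G z I := by
  rw [shearerQ_eq hI]
  exact mul_nonneg (Finset.prod_nonneg fun i _ => hz.1 i) (hz.2 _).le

/-- One layer of the recursion. The penalties gain the factor `1 - θ a * z (π a)` for every
`a ∈ I ∩ Z`: in Shearer's measure conditioned on layers below `I`, the partner `π a` occurs with
weight at least `z (π a)`. This gain turns `p` into `z`. -/
theorem prod_mul_sum_pairPenalty_le (hz : ShearerPos G z) (hp : ∀ i, 0 ≤ p i)
    (hθ0 : ∀ a ∈ Z, 0 ≤ θ a) (hθ1 : ∀ a ∈ Z, θ a ≤ 1)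
    (hπ : Set.InjOn π Z) (hadj : ∀ a ∈ Z, G.Adj a (π a))
    (hZ : ∀ a ∈ Z, p a * (1 - θ a * z (π a)) ≤ z a) (hnZ : ∀ a ∉ Z, p a ≤ z a)
    {I : Finset (Fin m)} (hI : G.IsIndepSet (I : Set (Fin m))) :
    (∏ i ∈ I, p i) * ∑ J ∈ (closedNbhd G I).powerset.filter
        (fun J : Finset (Fin m) => G.IsIndepSet (J : Set (Fin m))),
        pairPenalty Z π θ I J * shearerQ G z J ≤ shearerQ G z I := by
  set U := closedNbhd G I with hU
  set f : Fin m → ℝ := fun b => ∏ a ∈ (I.filter (· ∈ Z)).filter (fun a => π a = b), (1 - θ a)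
    with hf
  have hpen : ∀ J, pairPenalty Z π θ I J = ∏ b ∈ J, f b := by
    intro J
    unfold pairPenalty
    rw [← Finset.prod_fiberwise_of_maps_to (t := J) (g := π)
      (fun a ha => (Finset.mem_filter.1 ha).2.2)]
    refine Finset.prod_congr rfl fun b hb => Finset.prod_congr ?_ fun _ _ => rfl
    ext a
    simp only [Finset.mem_filter]
    constructor
    · rintro ⟨⟨h1, h2, _⟩, h4⟩; exact ⟨⟨h1, h2⟩, h4⟩
    · rintro ⟨⟨h1, h2⟩, rfl⟩; exact ⟨⟨h1, h2, hb⟩, rfl⟩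
  have hmem : ∀ {b a}, a ∈ (I.filter (· ∈ Z)).filter (fun a => π a = b) → a ∈ Z := fun h =>
    (Finset.mem_filter.1 (Finset.mem_filter.1 h).1).2
  have hf0 : ∀ b, 0 ≤ f b := fun b =>
    Finset.prod_nonneg fun a ha => sub_nonneg.2 (hθ1 a (hmem ha))
  have hf1 : ∀ b, f b ≤ 1 := fun b =>
    Finset.prod_le_one (fun a ha => sub_nonneg.2 (hθ1 a (hmem ha)))
      (fun a ha => by linarith [hθ0 a (hmem ha)])
  -- The partner map is injective, so every fibre has at most one element.
  have hfib : ∀ b, 1 - z b * (1 - f b)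
      = ∏ a ∈ (I.filter (· ∈ Z)).filter (fun a => π a = b), (1 - θ a * z (π a)) := by
    intro b
    by_cases hb : ∃ a ∈ I.filter (· ∈ Z), π a = b
    · obtain ⟨a, ha, rfl⟩ := hb
      have : (I.filter (· ∈ Z)).filter (fun a' => π a' = π a) = {a} := by
        ext x
        simp only [Finset.mem_filter, Finset.mem_singleton] at ha ⊢
        constructor
        · rintro ⟨⟨_, h2⟩, h3⟩; exact hπ h2 ha.2 h3
        · rintro rfl; exact ⟨ha, rfl⟩
      simp only [hf, this, Finset.prod_singleton]
      ring
    · have : (I.filter (· ∈ Z)).filter (fun a' => π a' = b) = ∅ :=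
        Finset.filter_eq_empty_iff.2 fun a ha h => hb ⟨a, ha, h⟩
      simp [hf, this]
  simp_rw [hpen]
  rw [sum_prod_mul_shearerQ, shearerQ_eq hI]
  set z' : Fin m → ℝ := fun i => if i ∈ U then z i * (1 - f i) else z i with hz'
  have hz'pos : ShearerPos G z' := by
    refine hz.mono (fun i => ?_) (fun i => ?_) <;> simp only [hz'] <;> split_ifs
    · exact mul_nonneg (hz.1 i) (sub_nonneg.2 (hf1 i))
    · exact hz.1 i
    · nlinarith [hz.1 i, hf0 i]
    · exact le_rfl
  have h1 := indepPoly_union_le hz'pos (B := U) (S := Uᶜ) disjoint_compl_right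
  rw [Finset.union_compl] at h1
  have h2 : indepPoly G Uᶜ z' = indepPoly G Uᶜ z :=
    indepPoly_congr fun i hi => if_neg (Finset.mem_compl.1 hi)
  have h3 : ∏ b ∈ U, (1 - z' b) = ∏ a ∈ I.filter (· ∈ Z), (1 - θ a * z (π a)) := by
    rw [← Finset.prod_fiberwise_of_maps_to (s := I.filter (· ∈ Z)) (t := U) (g := π)]
    · refine Finset.prod_congr rfl fun b hb => ?_
      simp only [hz', if_pos hb]
      exact hfib b
    · intro a ha
      rw [Finset.mem_filter] at ha
      simp only [hU, closedNbhd, Finset.mem_filter, Finset.mem_univ, true_and]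
      exact Or.inr ⟨a, ha.1, hadj a ha.2⟩
  rw [h2, h3] at h1
  have h4 : (∏ i ∈ I, p i) * ∏ a ∈ I.filter (· ∈ Z), (1 - θ a * z (π a)) ≤ ∏ i ∈ I, z i := by
    rw [Finset.prod_filter, ← Finset.prod_mul_distrib]
    have hz1 : ∀ b, z b ≤ 1 := by
      intro b
      have := hz.2 {b}
      rw [← insert_empty_eq, indepPoly_insert (Finset.notMem_empty b)] at this
      simp at this; linarith
    refine Finset.prod_le_prod (fun i _ => ?_) (fun i _ => ?_) <;> split_ifs with hi
    · have := mul_le_mul (hθ1 i hi) (hz1 (π i)) (hz.1 _) zero_le_one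
      exact mul_nonneg (hp i) (by linarith)
    · simpa using hp i
    · exact hZ i hi
    · simpa using hnZ i hi
  calc (∏ i ∈ I, p i) * indepPoly G Finset.univ z'
      ≤ (∏ i ∈ I, p i) * (indepPoly G Uᶜ z * ∏ a ∈ I.filter (· ∈ Z), (1 - θ a * z (π a))) :=
        mul_le_mul_of_nonneg_left h1 (Finset.prod_nonneg fun i _ => hp i)
    _ = ((∏ i ∈ I, p i) * ∏ a ∈ I.filter (· ∈ Z), (1 - θ a * z (π a))) * indepPoly G Uᶜ z := by ring
    _ ≤ _ := mul_le_mul_of_nonneg_right h4 (hz.2 _).le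

theorem shearerQ_empty : shearerQ G z ∅ = indepPoly G Finset.univ z := by
  rw [shearerQ_eq (by simp [SimpleGraph.IsIndepSet])]
  simp [closedNbhd]

theorem prod_mul_add_sum_layerStep_le (hz : ShearerPos G z) (hp : ∀ i, 0 ≤ p i)
    (hθ0 : ∀ a ∈ Z, 0 ≤ θ a) (hθ1 : ∀ a ∈ Z, θ a ≤ 1)
    (hπ : Set.InjOn π Z) (hadj : ∀ a ∈ Z, G.Adj a (π a))
    (hZ : ∀ a ∈ Z, p a * (1 - θ a * z (π a)) ≤ z a) (hnZ : ∀ a ∉ Z, p a ≤ z a)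
    {I : Finset (Fin m)} (hI : G.IsIndepSet (I : Set (Fin m))) :
    (∏ i ∈ I, p i) * (indepPoly G Finset.univ z
      + ∑ J ∈ Finset.univ.filter (LayerStep G I), pairPenalty Z π θ I J * shearerQ G z J)
      ≤ shearerQ G z I := by
  have step := prod_mul_sum_pairPenalty_le hz hp hθ0 hθ1 hπ hadj hZ hnZ hI
  have hsplit : (closedNbhd G I).powerset.filter
      (fun J : Finset (Fin m) => G.IsIndepSet (J : Set (Fin m)))
      = insert ∅ (Finset.univ.filter (LayerStep G I)) := by
    ext J
    simp only [Finset.mem_filter, Finset.mem_powerset, Finset.mem_insert, Finset.mem_univ,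
      true_and, LayerStep]
    rcases J.eq_empty_or_nonempty with rfl | h
    · simp [SimpleGraph.IsIndepSet]
    · simp [h, h.ne_empty, and_comm]
  have hnotin : (∅ : Finset (Fin m)) ∉ Finset.univ.filter (LayerStep G I) := by
    simp [LayerStep]
  have hpen0 : pairPenalty Z π θ I ∅ = 1 := by simp [pairPenalty]
  rw [hsplit, Finset.sum_insert hnotin, hpen0, shearerQ_empty, one_mul] at step
  exact step

theorem sum_layerWeight_le (hz : ShearerPos G z) (hp : ∀ i, 0 ≤ p i)
    (hθ0 : ∀ a ∈ Z, 0 ≤ θ a) (hθ1 : ∀ a ∈ Z, θ a ≤ 1)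
    (hπ : Set.InjOn π Z) (hadj : ∀ a ∈ Z, G.Adj a (π a))
    (hZ : ∀ a ∈ Z, p a * (1 - θ a * z (π a)) ≤ z a) (hnZ : ∀ a ∉ Z, p a ≤ z a)
    (n : ℕ) {I : Finset (Fin m)} (hI : G.IsIndepSet (I : Set (Fin m))) :
    ∑ L ∈ layeredLists G n I, layerWeight p Z π θ L
      ≤ shearerQ G z I / indepPoly G Finset.univ z := by
  have hu := hz.2 Finset.univ
  rw [le_div_iff₀ hu]
  induction n generalizing I with
  | zero =>
    have hpI : 0 ≤ ∏ i ∈ I, p i := Finset.prod_nonneg fun i _ => hp i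
    have step := prod_mul_add_sum_layerStep_le hz hp hθ0 hθ1 hπ hadj hZ hnZ hI
    have hbase : layerWeight p Z π θ [I] = ∏ i ∈ I, p i := by
      simp [layerWeight, pairPenalty]
    have hnn : ∀ J ∈ Finset.univ.filter (LayerStep G I),
        0 ≤ pairPenalty Z π θ I J * shearerQ G z J := fun J hJ =>
      mul_nonneg (pairPenalty_nonneg hθ1 _ _) (hz.shearerQ_nonneg (Finset.mem_filter.1 hJ).2.2.1)
    rw [layeredLists, Finset.sum_singleton, hbase]
    nlinarith [Finset.sum_nonneg hnn]
  | succ n ih =>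
    have hpI : 0 ≤ ∏ i ∈ I, p i := Finset.prod_nonneg fun i _ => hp i
    have step := prod_mul_add_sum_layerStep_le hz hp hθ0 hθ1 hπ hadj hZ hnZ hI
    have hbase : layerWeight p Z π θ [I] = ∏ i ∈ I, p i := by
      simp [layerWeight, pairPenalty]
    have hnil : [I] ∉ (Finset.univ.filter (LayerStep G I)).biUnion
        fun J => (layeredLists G n J).image (List.cons I) := by
      simp only [Finset.mem_biUnion, Finset.mem_image, not_exists, not_and]
      intro J _ L hL h
      obtain ⟨L', rfl⟩ := exists_cons_of_mem_layeredLists hL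
      simp at h
    have hdisj : ((Finset.univ.filter (LayerStep G I) : Finset (Finset (Fin m))) :
        Set (Finset (Fin m))).PairwiseDisjoint
        (fun J => (layeredLists G n J).image (List.cons I)) := by
      intro J _ J' _ hne
      rw [Function.onFun, Finset.disjoint_left]
      intro L h h'
      obtain ⟨L1, h1, rfl⟩ := Finset.mem_image.1 h
      obtain ⟨L2, h2, h3⟩ := Finset.mem_image.1 h'
      obtain ⟨L1', rfl⟩ := exists_cons_of_mem_layeredLists h1
      obtain ⟨L2', rfl⟩ := exists_cons_of_mem_layeredLists h2
      simp only [List.cons.injEq] at h3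
      exact hne h3.2.1.symm
    rw [layeredLists, Finset.sum_insert hnil, Finset.sum_biUnion hdisj, hbase]
    have hterm : ∀ J ∈ Finset.univ.filter (LayerStep G I),
        (∑ L ∈ (layeredLists G n J).image (List.cons I), layerWeight p Z π θ L)
          * indepPoly G Finset.univ z
        ≤ (∏ i ∈ I, p i) * (pairPenalty Z π θ I J * shearerQ G z J) := by
      intro J hJ
      have hJi := (Finset.mem_filter.1 hJ).2.2.1
      rw [Finset.sum_image (fun _ _ _ _ h => (List.cons.inj h).2)]
      have : ∀ L ∈ layeredLists G n J, layerWeight p Z π θ (I :: L)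
          = (∏ i ∈ I, p i) * pairPenalty Z π θ I J * layerWeight p Z π θ L := by
        intro L hL
        obtain ⟨L', rfl⟩ := exists_cons_of_mem_layeredLists hL
        rfl
      rw [Finset.sum_congr rfl this, ← Finset.mul_sum, mul_assoc, mul_assoc]
      refine mul_le_mul_of_nonneg_left
        (mul_le_mul_of_nonneg_left ?_ (pairPenalty_nonneg hθ1 _ _)) hpI
      exact ih hJi
    rw [add_mul, Finset.sum_mul]
    refine le_trans (add_le_add_right (Finset.sum_le_sum hterm) _) ?_
    rw [← Finset.mul_sum]
    linarith

theorem tsum_isLayered_le (hz : ShearerPos G z) (hp : ∀ i, 0 ≤ p i)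
    (hθ0 : ∀ a ∈ Z, 0 ≤ θ a) (hθ1 : ∀ a ∈ Z, θ a ≤ 1)
    (hπ : Set.InjOn π Z) (hadj : ∀ a ∈ Z, G.Adj a (π a))
    (hZ : ∀ a ∈ Z, p a * (1 - θ a * z (π a)) ≤ z a) (hnZ : ∀ a ∉ Z, p a ≤ z a) :
    ∑' L : {L // IsLayered G L}, ENNReal.ofReal (layerWeight p Z π θ L)
      ≤ ENNReal.ofReal (∑ i, shearerQ G z {i} / indepPoly G Finset.univ z) := by
  rw [ENNReal.tsum_eq_iSup_sum]
  refine iSup_le fun s => ?_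
  rw [← ENNReal.ofReal_sum_of_nonneg fun L _ => layerWeight_nonneg hp hθ1 L.1]
  refine ENNReal.ofReal_le_ofReal ?_
  set n := s.sup (fun L => L.1.length)
  have hind : ∀ i : Fin m, G.IsIndepSet (({i} : Finset (Fin m)) : Set (Fin m)) := fun i => by
    simp [SimpleGraph.IsIndepSet]
  have hsub : s.map (Function.Embedding.subtype _)
      ⊆ Finset.univ.biUnion fun i => layeredLists G n {i} := by
    intro L hL
    obtain ⟨⟨L, hL'⟩, hLs, rfl⟩ := Finset.mem_map.1 hL
    have hlen : L.length ≤ n := Finset.le_sup (f := fun L : {L // IsLayered G L} => L.1.length) hLs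
    obtain ⟨i, L', rfl, hc⟩ := hL'
    refine Finset.mem_biUnion.2 ⟨i, Finset.mem_univ i, mem_layeredLists hc ?_⟩
    simp at hlen; omega
  have hdisj : ((Finset.univ : Finset (Fin m)) : Set (Fin m)).PairwiseDisjoint
      (fun i => layeredLists G n {i}) := by
    intro i _ j _ hne
    rw [Function.onFun, Finset.disjoint_left]
    intro L h h'
    obtain ⟨L1, rfl⟩ := exists_cons_of_mem_layeredLists h
    obtain ⟨L2, h2⟩ := exists_cons_of_mem_layeredLists h'
    simp only [List.cons.injEq, Finset.singleton_inj] at h2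
    exact hne h2.1
  calc ∑ L ∈ s, layerWeight p Z π θ L.1
      = ∑ L ∈ s.map (Function.Embedding.subtype _), layerWeight p Z π θ L := by
        rw [Finset.sum_map]; rfl
    _ ≤ ∑ L ∈ Finset.univ.biUnion fun i => layeredLists G n {i}, layerWeight p Z π θ L :=
        Finset.sum_le_sum_of_subset_of_nonneg hsub fun L _ _ => layerWeight_nonneg hp hθ1 L
    _ = ∑ i, ∑ L ∈ layeredLists G n {i}, layerWeight p Z π θ L := Finset.sum_biUnion hdisj
    _ ≤ _ := Finset.sum_le_sum fun i _ =>
        sum_layerWeight_le hz hp hθ0 hθ1 hπ hadj hZ hnZ n (hind i)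

end Layers

/-! ### Layered lists on a table of samples -/

section Table

open scoped Classical

variable {m n : ℕ} {α : Fin n → Type*} {G : SimpleGraph (Fin m)} {vbl : Fin m → Finset (Fin n)}
  {A : Fin m → Set (∀ j, α j)} {x : ∀ j, ℕ → α j} {Z : Finset (Fin m)} {π : Fin m → Fin m}

/-- All vertices of a list of layers, with multiplicity. -/
def layerMult (L : List (Finset (Fin m))) : Multiset (Fin m) := (L.map Finset.val).sum

@[simp] theorem layerMult_nil : layerMult ([] : List (Finset (Fin m))) = 0 := rfl

@[simp] theorem layerMult_cons (I : Finset (Fin m)) (L : List (Finset (Fin m))) :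
    layerMult (I :: L) = I.val + layerMult L := rfl

@[simp] theorem layerMult_append (L M : List (Finset (Fin m))) :
    layerMult (L ++ M) = layerMult L + layerMult M := by
  simp [layerMult]

/-- The number of resamplings of the variable `j` when the events in `s` are resampled. -/
noncomputable def useCount (vbl : Fin m → Finset (Fin n)) (s : Multiset (Fin m)) (j : Fin n) : ℕ :=
  s.countP (fun i => j ∈ vbl i)

/-- The assignment read from the table `x` of samples after the events in `s` have been
resampled. -/
noncomputable def tableState (vbl : Fin m → Finset (Fin n)) (x : ∀ j, ℕ → α j)
    (s : Multiset (Fin m)) : ∀ j, α j :=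
  fun j => x j (useCount vbl s j)

/-- Every event in the list of layers holds just before it is resampled, when the layers are
resampled from the last one to the first one. -/
def Passes (vbl : Fin m → Finset (Fin n)) (A : Fin m → Set (∀ j, α j)) (x : ∀ j, ℕ → α j) :
    List (Finset (Fin m)) → Prop
  | [] => True
  | I :: L => (∀ i ∈ I, tableState vbl x (layerMult L) ∈ A i) ∧ Passes vbl A x L

/-- No pair `a ∈ I ∩ Z`, `π a ∈ J` passes with the two resamplings exchanged; here `J` is the layer
resampled just before `I`, and `s` are the events resampled before `J`. -/
def NoSwapAt (vbl : Fin m → Finset (Fin n)) (A : Fin m → Set (∀ j, α j)) (x : ∀ j, ℕ → α j)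
    (Z : Finset (Fin m)) (π : Fin m → Fin m) (I J : Finset (Fin m)) (s : Multiset (Fin m)) : Prop :=
  ∀ a ∈ I, a ∈ Z → π a ∈ J →
    ¬ (tableState vbl x ((J.erase (π a)).val + s) ∈ A a ∧
      tableState vbl x (a ::ₘ ((J.erase (π a)).val + s)) ∈ A (π a))

/-- `NoSwapAt` for all pairs of consecutive layers. -/
def NoSwap (vbl : Fin m → Finset (Fin n)) (A : Fin m → Set (∀ j, α j)) (x : ∀ j, ℕ → α j)
    (Z : Finset (Fin m)) (π : Fin m → Fin m) : List (Finset (Fin m)) → Prop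
  | [] => True
  | [_] => True
  | I :: J :: L => NoSwapAt vbl A x Z π I J (layerMult L) ∧ NoSwap vbl A x Z π (J :: L)

/-- The number of pairs `a ∈ s ∩ Z`, `b ∈ t` with `b = π a`. -/
noncomputable def pairCount (Z : Finset (Fin m)) (π : Fin m → Fin m) (s t : Multiset (Fin m)) : ℕ :=
  (s.map fun a => t.countP (fun b => a ∈ Z ∧ b = π a)).sum

/-- The number of pairs in which some `a ∈ Z` is resampled after its partner `π a`. -/
noncomputable def inversions (Z : Finset (Fin m)) (π : Fin m → Fin m) :
    List (Finset (Fin m)) → ℕ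
  | [] => 0
  | I :: L => inversions Z π L + pairCount Z π I.val (layerMult L)

/-- The number of layers plus the sum of the depths of all vertices. -/
def totalDepth : List (Finset (Fin m)) → ℕ
  | [] => 0
  | _ :: L => 1 + totalDepth L + (layerMult L).card

@[simp] theorem useCount_add (s t : Multiset (Fin m)) (j : Fin n) :
    useCount vbl (s + t) j = useCount vbl s j + useCount vbl t j := by
  simp [useCount]

@[simp] theorem useCount_zero (j : Fin n) : useCount vbl 0 j = 0 := by
  simp [useCount]

theorem useCount_cons (i : Fin m) (s : Multiset (Fin m)) (j : Fin n) :
    useCount vbl (i ::ₘ s) j = useCount vbl s j + if j ∈ vbl i then 1 else 0 := by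
  simp [useCount, Multiset.countP_cons]

@[simp] theorem pairCount_zero_left (t : Multiset (Fin m)) : pairCount Z π 0 t = 0 := by
  simp [pairCount]

theorem pairCount_add_left (s s' t : Multiset (Fin m)) :
    pairCount Z π (s + s') t = pairCount Z π s t + pairCount Z π s' t := by
  simp [pairCount]

theorem pairCount_add_right (s t t' : Multiset (Fin m)) :
    pairCount Z π s (t + t') = pairCount Z π s t + pairCount Z π s t' := by
  simp [pairCount, Multiset.sum_map_add]

theorem pairCount_eq_zero {s t : Multiset (Fin m)} (h : ∀ a ∈ s, a ∈ Z → π a ∉ t) :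
    pairCount Z π s t = 0 := by
  refine Multiset.sum_eq_zero fun c hc => ?_
  obtain ⟨a, ha, rfl⟩ := Multiset.mem_map.1 hc
  exact Multiset.countP_eq_zero.2 fun b hb h' => h a ha h'.1 (h'.2 ▸ hb)

theorem pairCount_singleton {a : Fin m} (ha : a ∈ Z) : pairCount Z π {a} {π a} = 1 := by
  rw [pairCount, Multiset.map_singleton, Multiset.sum_singleton,
    ← Multiset.cons_zero (π a), Multiset.countP_cons_of_pos _ ⟨ha, rfl⟩, Multiset.countP_zero]

/-- Membership in `A i` only depends on how often the variables of `A i` have been resampled. -/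
theorem tableState_mem_congr (hvbl : ∀ i, DependsOn (fun x => x ∈ A i) (vbl i : Set (Fin n)))
    {i : Fin m} {s t : Multiset (Fin m)} (h : ∀ j ∈ vbl i, useCount vbl s j = useCount vbl t j)
    (hs : tableState vbl x s ∈ A i) : tableState vbl x t ∈ A i := by
  have := hvbl i (x := tableState vbl x s) (y := tableState vbl x t) fun j hj => by
    simp only [tableState, h j hj]
  exact this.mp hs

theorem disjoint_vbl (hG : canonicalDependencyGraph vbl ≤ G) {i k : Fin m} (hne : i ≠ k)
    (h : ¬ G.Adj i k) {j : Fin n} (hi : j ∈ vbl i) : j ∉ vbl k := fun hk =>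
  h (hG ⟨hne, j, Finset.mem_inter.2 ⟨hi, hk⟩⟩)

theorem useCount_eq_zero (hG : canonicalDependencyGraph vbl ≤ G) {i : Fin m}
    {s : Multiset (Fin m)} (h : ∀ k ∈ s, i ≠ k ∧ ¬ G.Adj i k) {j : Fin n} (hj : j ∈ vbl i) :
    useCount vbl s j = 0 :=
  Multiset.countP_eq_zero.2 fun k hk => disjoint_vbl hG (h k hk).1 (h k hk).2 hj

theorem Passes.of_append {L M : List (Finset (Fin m))} (h : Passes vbl A x (L ++ M)) :
    Passes vbl A x M := by
  induction L with
  | nil => exact h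
  | cons I L ih => exact ih h.2

theorem Passes.append_congr {L M M' : List (Finset (Fin m))} (hM : layerMult M = layerMult M')
    (h : Passes vbl A x (L ++ M)) (h' : Passes vbl A x M') : Passes vbl A x (L ++ M') := by
  induction L with
  | nil => exact h'
  | cons I L ih =>
    refine ⟨?_, ih h.2⟩
    have := h.1
    simp only [List.append_eq, layerMult_append, hM] at this ⊢
    exact this

theorem inversions_append_congr {M M' : List (Finset (Fin m))} (hM : layerMult M = layerMult M')
    (L : List (Finset (Fin m))) :
    inversions Z π (L ++ M) + inversions Z π M' = inversions Z π (L ++ M') + inversions Z π M := by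
  induction L with
  | nil => simp [add_comm]
  | cons I L ih =>
    simp only [List.cons_append, inversions, layerMult_append, hM] at ih ⊢
    omega

theorem totalDepth_append_congr {M M' : List (Finset (Fin m))} (hM : layerMult M = layerMult M')
    (L : List (Finset (Fin m))) :
    totalDepth (L ++ M) + totalDepth M' = totalDepth (L ++ M') + totalDepth M := by
  induction L with
  | nil => simp [add_comm]
  | cons I L ih =>
    simp only [List.cons_append, totalDepth, layerMult_append, hM] at ih ⊢
    omega

/-- Lists of independent layers that pass, start with the layer `{i}`, and contain `i` exactly `k`
times. -/
def IsCandidate (G : SimpleGraph (Fin m)) (vbl : Fin m → Finset (Fin n))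
    (A : Fin m → Set (∀ j, α j)) (x : ∀ j, ℕ → α j) (i : Fin m) (k : ℕ)
    (L : List (Finset (Fin m))) : Prop :=
  (∃ L', L = {i} :: L') ∧ (∀ I ∈ L, G.IsIndepSet (I : Set (Fin m))) ∧ Passes vbl A x L ∧
    (layerMult L).count i = k

/-- Candidates are compared by size plus number of inversions, and then by total depth. -/
noncomputable def candidateRank (Z : Finset (Fin m)) (π : Fin m → Fin m)
    (L : List (Finset (Fin m))) : ℕ ×ₗ ℕ :=
  toLex ((layerMult L).card + inversions Z π L, totalDepth L)

theorem isChain_of_forall_append {β : Type*} {R : β → β → Prop} {L : List β}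
    (h : ∀ L₁ a b L₂, L = L₁ ++ a :: b :: L₂ → R a b) : L.IsChain R := by
  induction L with
  | nil => exact List.isChain_nil
  | cons a L ih =>
    cases L with
    | nil => exact List.isChain_singleton a
    | cons b L =>
      exact List.isChain_cons_cons.2 ⟨h [] a b L rfl,
        ih fun L₁ c d L₂ hL => h (a :: L₁) c d L₂ (by rw [hL]; rfl)⟩

theorem noSwap_of_forall_append {L : List (Finset (Fin m))}
    (h : ∀ L₁ I J L₂, L = L₁ ++ I :: J :: L₂ → NoSwapAt vbl A x Z π I J (layerMult L₂)) :
    NoSwap vbl A x Z π L := by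
  induction L with
  | nil => trivial
  | cons I L ih =>
    cases L with
    | nil => trivial
    | cons J L =>
      exact ⟨h [] I J L rfl, ih fun L₁ I' J' L₂ hL => h (I :: L₁) I' J' L₂ (by rw [hL]; rfl)⟩

section Minimal

variable {i : Fin m} {k : ℕ} {L : List (Finset (Fin m))}

/-- In a candidate of minimal rank, no block behind the first layer can be replaced by a passing
block of the same vertices with fewer inversions, or as many inversions and smaller depth. -/
theorem not_lt_of_minimal_block
    (hmin : ∀ L', IsCandidate G vbl A x i k L' → ¬ candidateRank Z π L' < candidateRank Z π L)
    (hL : IsCandidate G vbl A x i k L) {L₁ M M' : List (Finset (Fin m))}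
    (hLM : L = {i} :: (L₁ ++ M)) (hM : layerMult M = layerMult M')
    (hind : ∀ I ∈ M', G.IsIndepSet (I : Set (Fin m))) (hpass : Passes vbl A x M') :
    ¬ (inversions Z π M' < inversions Z π M ∨
      inversions Z π M' = inversions Z π M ∧ totalDepth M' < totalDepth M) := by
  intro hlt
  subst hLM
  obtain ⟨_, h2, h3, h4⟩ := hL
  refine hmin ({i} :: (L₁ ++ M')) ⟨⟨_, rfl⟩, ?_, ?_, ?_⟩ ?_
  · intro I hI
    simp only [List.mem_cons, List.mem_append] at hI h2
    rcases hI with hI | hI | hI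
    · exact h2 I (Or.inl hI)
    · exact h2 I (Or.inr (Or.inl hI))
    · exact hind I hI
  · exact Passes.append_congr (L := {i} :: L₁) hM h3 hpass
  · rw [← h4]; simp [hM]
  · have e1 := inversions_append_congr (Z := Z) (π := π) hM ({i} :: L₁)
    have e2 := totalDepth_append_congr hM ({i} :: L₁)
    simp only [List.cons_append] at e1 e2
    have e3 : (layerMult ({i} :: (L₁ ++ M))).card = (layerMult ({i} :: (L₁ ++ M'))).card := by
      simp [hM]
    rw [candidateRank, candidateRank, Prod.Lex.toLex_lt_toLex]
    omega

/-- In a candidate of minimal rank, the first layer needs every vertex of the second one. -/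
theorem not_mem_of_minimal_head
    (hmin : ∀ L', IsCandidate G vbl A x i k L' → ¬ candidateRank Z π L' < candidateRank Z π L)
    (hL : IsCandidate G vbl A x i k L)
    {J : Finset (Fin m)} {L₂ : List (Finset (Fin m))} (hLJ : L = {i} :: J :: L₂)
    {u : Fin m} (hu : u ≠ i)
    (hpass : tableState vbl x ((J.erase u).val + layerMult L₂) ∈ A i) : u ∉ J := by
  intro huJ
  subst hLJ
  obtain ⟨_, h2, h3, h4⟩ := hL
  have hJ : J.val = {u} + (J.erase u).val := by
    rw [Finset.erase_val, Multiset.singleton_add, Multiset.cons_erase huJ]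
  refine hmin ({i} :: J.erase u :: L₂) ⟨⟨_, rfl⟩, ?_, ⟨?_, ?_, ?_⟩, ?_⟩ ?_
  · intro I hI
    simp only [List.mem_cons] at hI h2
    rcases hI with hI | hI | hI
    · exact h2 I (Or.inl hI)
    · rw [hI]; exact (h2 J (Or.inr (Or.inl rfl))).mono (by simp)
    · exact h2 I (Or.inr (Or.inr hI))
  · intro i' hi'
    rw [Finset.mem_singleton.1 hi']
    exact hpass
  · exact fun v hv => h3.2.1 v (Finset.mem_of_mem_erase hv)
  · exact h3.2.2
  · rw [← h4]
    simp only [layerMult_cons, hJ, Multiset.count_add, Multiset.count_singleton, hu.symm,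
      if_false, zero_add]
  · rw [candidateRank, candidateRank, Prod.Lex.toLex_lt_toLex]
    left
    simp only [layerMult_cons, inversions, hJ, pairCount_add_left, pairCount_add_right,
      Multiset.card_add, Multiset.card_singleton]
    omega

end Minimal

/-- A passing list of independent layers can be replaced by a layered one in which no pair passes
with the order exchanged, without changing the last resampled event and its multiplicity. -/
theorem exists_isLayered_noSwap (hG : canonicalDependencyGraph vbl ≤ G)
    (hvbl : ∀ i, DependsOn (fun x => x ∈ A i) (vbl i : Set (Fin n)))
    (hadj : ∀ a ∈ Z, G.Adj a (π a)) (hπZ : ∀ a ∈ Z, π a ∉ Z)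
    {i : Fin m} {k : ℕ} (h : ∃ L, IsCandidate G vbl A x i k L) :
    ∃ L, IsLayered G L ∧ (∃ L', L = {i} :: L') ∧ (layerMult L).count i = k ∧
      Passes vbl A x L ∧ NoSwap vbl A x Z π L := by
  obtain ⟨L, hL, hmin⟩ := WellFounded.has_min
    (InvImage.wf (candidateRank Z π) (wellFounded_lt (α := ℕ ×ₗ ℕ)))
    {L | IsCandidate G vbl A x i k L} h
  replace hmin : ∀ L', IsCandidate G vbl A x i k L' →
      ¬ candidateRank Z π L' < candidateRank Z π L := hmin
  have hind : ∀ I ∈ L, G.IsIndepSet (I : Set (Fin m)) := hL.2.1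
  have hpass : Passes vbl A x L := hL.2.2.1
  obtain ⟨L', hLL'⟩ := hL.1
  -- Two consecutive layers are either at the head or strictly behind it.
  have hcases : ∀ {P : List (Finset (Fin m))} {I J L₂}, L = P ++ I :: J :: L₂ →
      (I = {i} ∧ L = {i} :: J :: L₂) ∨ ∃ L₁, L = {i} :: (L₁ ++ I :: J :: L₂) := by
    intro P I J L₂ hP
    cases P with
    | nil =>
      rw [List.nil_append, hLL'] at hP
      injection hP with h1 h2
      exact Or.inl ⟨h1.symm, by rw [hLL', h2]⟩
    | cons K P =>
      rw [hLL', List.cons_append] at hP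
      injection hP with h1 h2
      exact Or.inr ⟨P, by rw [hLL', h2]⟩
  have hnonempty : ∀ {L₁ : List (Finset (Fin m))} {J L₂}, L = {i} :: (L₁ ++ J :: L₂) →
      J.Nonempty := by
    intro L₁ J L₂ hP
    rw [Finset.nonempty_iff_ne_empty]
    rintro rfl
    refine not_lt_of_minimal_block hmin hL hP (M' := L₂) (by simp) (fun I hI => hind I ?_) ?_
      (Or.inr ⟨by simp [inversions], by simp only [totalDepth]; omega⟩)
    · rw [hP]; simp [hI]
    · rw [hP] at hpass
      exact (Passes.of_append (L := {i} :: L₁) hpass).2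
  have hnbhd : ∀ {P : List (Finset (Fin m))} {I J L₂}, L = P ++ I :: J :: L₂ →
      J ⊆ closedNbhd G I := by
    intro P I J L₂ hP u huJ
    by_contra hu
    simp only [closedNbhd, Finset.mem_filter, Finset.mem_univ, true_and, not_or, not_exists,
      not_and] at hu
    have hIi : G.IsIndepSet (I : Set (Fin m)) := hind I (by rw [hP]; simp)
    have hJi : G.IsIndepSet (J : Set (Fin m)) := hind J (by rw [hP]; simp)
    have hJ : J.val = {u} + (J.erase u).val := by
      rw [Finset.erase_val, Multiset.singleton_add, Multiset.cons_erase huJ]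
    have hp2 := Passes.of_append (hP ▸ hpass)
    have hIpass : ∀ i' ∈ I, tableState vbl x ((J.erase u).val + layerMult L₂) ∈ A i' := by
      intro i' hi'
      refine tableState_mem_congr hvbl (fun j hj => ?_) (hp2.1 i' hi')
      rw [layerMult_cons, hJ, add_assoc, useCount_add {u},
        useCount_eq_zero hG (i := i') (s := {u}) ?_ hj, zero_add]
      intro u' hu'
      rw [Multiset.mem_singleton.1 hu']
      exact ⟨fun h => hu.1 (h ▸ hi'), hu.2 i' hi'⟩
    rcases hcases hP with ⟨rfl, hLh⟩ | ⟨L₁, hLh⟩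
    · exact not_mem_of_minimal_head hmin hL hLh
        (fun h => hu.1 (by simp [h])) (hIpass i (by simp)) huJ
    · have huI : (insert u I).val = {u} + I.val := by
        rw [Finset.insert_val_of_notMem hu.1, Multiset.singleton_add]
      refine not_lt_of_minimal_block hmin hL hLh (M' := insert u I :: J.erase u :: L₂) ?_ ?_ ?_
        (Or.inr ⟨?_, ?_⟩)
      · simp only [layerMult_cons, huI, hJ]
        abel
      · intro K hK
        simp only [List.mem_cons] at hK
        rcases hK with rfl | rfl | hK
        · exact (isIndepSet_insert_iff hu.1).2 ⟨hIi, fun j hj h => hu.2 j hj h.symm⟩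
        · exact hJi.mono (by simp)
        · exact hind K (by rw [hP]; simp [hK])
      · refine ⟨fun i' hi' => ?_, fun v hv => hp2.2.1 v (Finset.mem_of_mem_erase hv), hp2.2.2⟩
        rcases Finset.mem_insert.1 hi' with rfl | hi'
        · refine tableState_mem_congr hvbl (fun j hj => ?_) (hp2.2.1 i' huJ)
          rw [layerMult_cons, useCount_add,
            useCount_eq_zero hG (i := i') (s := (J.erase i').val) ?_ hj, zero_add]
          intro v hv
          have hv' : v ∈ J.erase i' := hv
          have hne := (Finset.ne_of_mem_erase hv').symm
          exact ⟨hne, hJi huJ (Finset.mem_of_mem_erase hv') hne⟩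
        · exact hIpass i' hi'
      · have z1 : pairCount Z π I.val {u} = 0 := pairCount_eq_zero fun a ha haZ h =>
          hu.2 a ha (Multiset.mem_singleton.1 h ▸ hadj a haZ)
        have z2 : pairCount Z π {u} (J.erase u).val = 0 := pairCount_eq_zero fun a ha haZ h => by
          rw [Multiset.mem_singleton.1 ha] at h haZ
          have h' : π u ∈ J.erase u := h
          exact hJi huJ (Finset.mem_of_mem_erase h') (Finset.ne_of_mem_erase h').symm (hadj u haZ)
        simp only [inversions, layerMult_cons, huI, hJ, pairCount_add_left, pairCount_add_right,
          z1, z2]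
        omega
      · simp only [totalDepth, layerMult_cons, hJ, Multiset.card_add, Multiset.card_singleton]
        omega
  have hswap : ∀ {P : List (Finset (Fin m))} {I J L₂}, L = P ++ I :: J :: L₂ →
      NoSwapAt vbl A x Z π I J (layerMult L₂) := by
    rintro P I J L₂ hP a haI haZ hbJ ⟨hs1, hs2⟩
    have hIi : G.IsIndepSet (I : Set (Fin m)) := hind I (by rw [hP]; simp)
    have hJi : G.IsIndepSet (J : Set (Fin m)) := hind J (by rw [hP]; simp)
    have hp2 := Passes.of_append (hP ▸ hpass)
    have hba : π a ≠ a := (hadj a haZ).ne'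
    rcases hcases hP with ⟨rfl, hLh⟩ | ⟨L₁, hLh⟩
    · obtain rfl := Finset.mem_singleton.1 haI
      exact not_mem_of_minimal_head hmin hL hLh hba hs1 hbJ
    · have hJ : J.val = {π a} + (J.erase (π a)).val := by
        rw [Finset.erase_val, Multiset.singleton_add, Multiset.cons_erase hbJ]
      have hI : I.val = {a} + (I.erase a).val := by
        rw [Finset.erase_val, Multiset.singleton_add, Multiset.cons_erase haI]
      refine not_lt_of_minimal_block hmin hL hLh
        (M' := I.erase a :: {π a} :: {a} :: J.erase (π a) :: L₂) ?_ ?_ ?_ (Or.inl ?_)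
      · simp only [layerMult_cons, hI, hJ, Finset.singleton_val]
        abel
      · intro K hK
        simp only [List.mem_cons] at hK
        rcases hK with rfl | rfl | rfl | rfl | hK
        · exact hIi.mono (by simp)
        · simp [SimpleGraph.IsIndepSet]
        · simp [SimpleGraph.IsIndepSet]
        · exact hJi.mono (by simp)
        · exact hind K (by rw [hP]; simp [hK])
      · refine ⟨fun i' hi' => ?_, fun b hb => ?_, fun a' ha' => ?_,
          fun v hv => hp2.2.1 v (Finset.mem_of_mem_erase hv), hp2.2.2⟩
        · refine tableState_mem_congr hvbl (fun j hj => ?_) (hp2.1 i' (Finset.mem_of_mem_erase hi'))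
          have h0 : useCount vbl {a} j = 0 := useCount_eq_zero hG (i := i') (fun c hc => by
            rw [Multiset.mem_singleton.1 hc]
            have hne := Finset.ne_of_mem_erase hi'
            exact ⟨hne, hIi (Finset.mem_of_mem_erase hi') haI hne⟩) hj
          simp only [layerMult_cons, hJ, Finset.singleton_val, useCount_add, h0]
          omega
        · rw [Finset.mem_singleton.1 hb]
          exact hs2
        · rw [Finset.mem_singleton.1 ha']
          exact hs1
      · have z1 : pairCount Z π (I.erase a).val {a} = 0 := pairCount_eq_zero fun c _ hcZ h =>
          hπZ c hcZ (Multiset.mem_singleton.1 h ▸ haZ)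
        have z2 : ∀ t, pairCount Z π {π a} t = 0 := fun t => pairCount_eq_zero fun c hc hcZ =>
          absurd (Multiset.mem_singleton.1 hc ▸ hcZ) (hπZ a haZ)
        have z3 := pairCount_singleton (π := π) haZ
        simp only [inversions, layerMult_cons, hI, hJ, Finset.singleton_val, pairCount_add_left,
          pairCount_add_right, z1, z2, z3]
        omega
  refine ⟨L, ⟨i, L', hLL', isChain_of_forall_append fun P I J L₂ hP => ⟨?_, ?_, hnbhd hP⟩⟩,
    hL.1, hL.2.2.2, hpass, noSwap_of_forall_append fun P I J L₂ hP => hswap hP⟩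
  · rcases hcases hP with ⟨_, hLh⟩ | ⟨L₁, hLh⟩
    · exact hnonempty (L₁ := []) hLh
    · exact hnonempty (L₁ := L₁ ++ [I]) (by simpa using hLh)
  · exact hind J (by rw [hP]; simp)

/-- The resampled events up to round `t` as a list of one-element layers, latest first. -/
def history (s : ℕ → Option (Fin m)) : ℕ → List (Finset (Fin m))
  | 0 => []
  | t + 1 => (s t).elim (history s t) fun i => {i} :: history s t

theorem mtState_eq_tableState (s : ℕ → Option (Fin m)) (t : ℕ) :
    mtState vbl x s t = tableState vbl x (layerMult (history s t)) := by
  funext j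
  unfold mtState tableState
  congr 1
  induction t with
  | zero => simp [history]
  | succ t ih =>
    rw [Finset.range_add_one, Finset.filter_insert]
    cases hs : s t with
    | none => simpa [history, hs] using ih
    | some i =>
      by_cases hj : j ∈ vbl i
      · simp [history, hs, hj, ih, useCount_cons]
      · simp [history, hs, hj, ih, useCount_cons]

theorem isIndepSet_of_mem_history (s : ℕ → Option (Fin m)) (t : ℕ) :
    ∀ I ∈ history s t, G.IsIndepSet (I : Set (Fin m)) := by
  induction t with
  | zero => simp [history]
  | succ t ih =>
    cases hs : s t with
    | none => simpa [history, hs] using ih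
    | some i => simpa [history, hs, SimpleGraph.IsIndepSet] using ih

theorem passes_history {s : ℕ → Option (Fin m)}
    (h : ∀ t i, s t = some i → mtState vbl x s t ∈ A i) (t : ℕ) :
    Passes vbl A x (history s t) := by
  induction t with
  | zero => trivial
  | succ t ih =>
    cases hs : s t with
    | none => simpa [history, hs] using ih
    | some i =>
      simp only [history, hs, Option.elim_some]
      refine ⟨fun i' hi' => ?_, ih⟩
      rw [Finset.mem_singleton.1 hi', ← mtState_eq_tableState]
      exact h t i hs

theorem count_history_mono (s : ℕ → Option (Fin m)) (i : Fin m) :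
    Monotone fun t => (layerMult (history s t)).count i := by
  refine monotone_nat_of_le_succ fun t => ?_
  cases hs : s t with
  | none => simp [history, hs]
  | some i' => simp [history, hs, Multiset.count_cons]

/-- A run takes at most as many steps as there are layered lists that pass and in which no pair
passes with the order exchanged: the last event and its multiplicity determine the step. -/
theorem encard_steps_le (hG : canonicalDependencyGraph vbl ≤ G)
    (hvbl : ∀ i, DependsOn (fun x => x ∈ A i) (vbl i : Set (Fin n)))
    (hadj : ∀ a ∈ Z, G.Adj a (π a)) (hπZ : ∀ a ∈ Z, π a ∉ Z) {s : ℕ → Option (Fin m)}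
    (h : ∀ t i, s t = some i → mtState vbl x s t ∈ A i) :
    {t : ℕ | s t ≠ none}.encard
      ≤ {L | IsLayered G L ∧ Passes vbl A x L ∧ NoSwap vbl A x Z π L}.encard := by
  have key : ∀ t : ℕ, ∃ L, ∀ i, s t = some i → IsLayered G L ∧ (∃ L', L = {i} :: L') ∧
      (layerMult L).count i = (layerMult (history s (t + 1))).count i ∧
      Passes vbl A x L ∧ NoSwap vbl A x Z π L := by
    intro t
    cases hs : s t with
    | none => exact ⟨[], fun i hi => by simp at hi⟩
    | some i =>
      obtain ⟨L, hL⟩ := exists_isLayered_noSwap (x := x) hG hvbl hadj hπZ (i := i)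
        ⟨history s (t + 1), ⟨history s t, by simp [history, hs]⟩,
          isIndepSet_of_mem_history s (t + 1), passes_history h (t + 1), rfl⟩
      exact ⟨L, fun i' hi' => by
        obtain rfl := Option.some.inj hi'
        exact hL⟩
  choose F hF using key
  refine Set.encard_le_encard_of_injOn (f := F) ?_ ?_
  · intro t ht
    obtain ⟨i, hi⟩ := Option.ne_none_iff_exists'.1 ht
    have := hF t i hi
    exact ⟨this.1, this.2.2.2⟩
  · have hlt : ∀ t t' : ℕ, t < t' → s t ≠ none → s t' ≠ none → F t ≠ F t' := by
      intro t t' htt' ht ht' he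
      obtain ⟨i, hi⟩ := Option.ne_none_iff_exists'.1 ht
      obtain ⟨i', hi'⟩ := Option.ne_none_iff_exists'.1 ht'
      obtain ⟨_, ⟨L1, h1⟩, h2, _⟩ := hF t i hi
      obtain ⟨_, ⟨L2, h3⟩, h4, _⟩ := hF t' i' hi'
      rw [he, h3] at h1
      obtain rfl : i' = i := Finset.singleton_inj.1 (List.cons.inj h1).1
      rw [he, h4] at h2
      have h5 := count_history_mono s i' (Nat.succ_le_of_lt htt')
      simp only [history, hi', Option.elim_some, layerMult_cons, Finset.singleton_val,
        Multiset.singleton_add, Multiset.count_cons_self] at h2 h5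
      simp only [hi, Option.elim_some, layerMult_cons, Finset.singleton_val,
        Multiset.singleton_add, Multiset.count_cons_self] at h2 h5
      omega
    intro t ht t' ht' he
    rcases lt_trichotomy t t' with h1 | h1 | h1
    · exact absurd he (hlt t t' h1 ht ht')
    · exact h1
    · exact absurd he.symm (hlt t' t h1 ht' ht)

end Table

/-! ### Independence of the entries of a random table -/

section Probability

open scoped Classical

/-- Let `Y`, `W` be independent with law `μ`. If `Y'` arises from `Y` by taking the coordinates in
`S` from `W`, then `Y` and `Y'` both lie in `B` with probability at least `μ B ^ 2`: conditionally
on the common coordinates they are independent with the same law. -/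
theorem sq_measure_le_prod_mix {n : ℕ} {α : Fin n → Type*} [∀ j, MeasurableSpace (α j)]
    (ν : Measure (∀ j, α j)) [IsProbabilityMeasure ν] (S : Finset (Fin n))
    (hmix : (ν.prod ν).map (fun yw : (∀ j, α j) × (∀ j, α j) =>
      fun j => if j ∈ S then yw.2 j else yw.1 j) = ν)
    {B : Set (∀ j, α j)} (hB : MeasurableSet B) :
    ν B ^ 2 ≤ (ν.prod ν) {yw | yw.1 ∈ B ∧ (fun j => if j ∈ S then yw.2 j else yw.1 j) ∈ B} := by
  set mix : (∀ j, α j) × (∀ j, α j) → (∀ j, α j) :=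
    fun yw j => if j ∈ S then yw.2 j else yw.1 j with hmixdef
  have hmeas : Measurable mix := by
    refine measurable_pi_iff.2 fun j => ?_
    by_cases hj : j ∈ S
    · simp only [hmixdef, hj, if_true]
      exact (measurable_pi_apply j).comp measurable_snd
    · simp only [hmixdef, hj, if_false]
      exact (measurable_pi_apply j).comp measurable_fst
  have hM : MeasurableSet (mix ⁻¹' B) := hmeas hB
  -- the probability of `B` given the coordinates outside `S`
  set g : (∀ j, α j) → ℝ≥0∞ := fun y => ν (Prod.mk y ⁻¹' (mix ⁻¹' B)) with hg
  have hgm : Measurable g := measurable_measure_prodMk_left hM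
  have hgmix : ∀ y w, g (mix (y, w)) = g y := by
    intro y w
    have : ∀ v, mix (mix (y, w), v) = mix (y, v) := by
      intro v; funext j; by_cases hj : j ∈ S <;> simp [hmixdef, hj]
    simp only [hg, Set.preimage, Set.mem_ofPred_eq, this]
  have h1 : ν B = ∫⁻ y, g y ∂ν := by
    conv_lhs => rw [← hmix]
    rw [Measure.map_apply hmeas hB, Measure.prod_apply hM]
  have h2 : (ν.prod ν) {yw | yw.1 ∈ B ∧ mix yw ∈ B} = ∫⁻ y, g y ^ (2 : ℝ) ∂ν := by
    have hset : {yw : (∀ j, α j) × (∀ j, α j) | yw.1 ∈ B ∧ mix yw ∈ B}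
        = (Prod.fst ⁻¹' B) ∩ (mix ⁻¹' B) := rfl
    have e1 : (ν.prod ν) {yw | yw.1 ∈ B ∧ mix yw ∈ B} = ∫⁻ y, B.indicator g y ∂ν := by
      rw [hset, Measure.prod_apply ((measurable_fst hB).inter hM)]
      refine lintegral_congr fun y => ?_
      by_cases hy : y ∈ B
      · rw [Set.indicator_of_mem hy]
        congr 1
        ext w; simp [hy]
      · rw [Set.indicator_of_notMem hy]
        convert measure_empty (μ := ν)
        ext w; simp [hy]
    rw [e1]
    conv_lhs => rw [← hmix]
    rw [lintegral_map (hgm.indicator hB) hmeas,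
      lintegral_prod (fun yw => B.indicator g (mix yw))
        ((hgm.indicator hB).comp hmeas).aemeasurable]
    refine lintegral_congr fun y => ?_
    have e2 : ∀ w, B.indicator g (mix (y, w))
        = (Prod.mk y ⁻¹' (mix ⁻¹' B)).indicator (fun _ => g y) w := by
      intro w
      by_cases hw : mix (y, w) ∈ B
      · rw [Set.indicator_of_mem hw, Set.indicator_of_mem (by exact hw), hgmix]
      · rw [Set.indicator_of_notMem hw, Set.indicator_of_notMem (by exact hw)]
    simp_rw [e2]
    rw [lintegral_indicator_const (measurable_prodMk_left hM)]
    rw [ENNReal.rpow_two, sq]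
  rw [h2, h1]
  have hc : (2 : ℝ).HolderConjugate 2 := by
    rw [Real.holderConjugate_iff]; norm_num
  have h3 := ENNReal.lintegral_mul_le_Lp_mul_Lq ν hc hgm.aemeasurable
    (g := fun _ => 1) aemeasurable_const
  simp only [Pi.mul_apply, mul_one, ENNReal.one_rpow, lintegral_const, measure_univ] at h3
  calc (∫⁻ y, g y ∂ν) ^ 2 ≤ ((∫⁻ y, g y ^ (2 : ℝ) ∂ν) ^ (1 / (2 : ℝ))) ^ 2 := by gcongr
    _ = ∫⁻ y, g y ^ (2 : ℝ) ∂ν := by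
      rw [← ENNReal.rpow_two, ← ENNReal.rpow_mul]; norm_num

variable {m n : ℕ} {α : Fin n → Type*} [∀ j, MeasurableSpace (α j)]
  {μ : ∀ j, Measure (α j)}
  {G : SimpleGraph (Fin m)} {vbl : Fin m → Finset (Fin n)}
  {A : Fin m → Set (∀ j, α j)} {Z : Finset (Fin m)} {π : Fin m → Fin m}
  {p θ : Fin m → ℝ}
  {Ω : Type*} {X : ∀ j, ℕ → Ω → α j}

/-- The σ-algebra generated by the entries in `C` of the table of samples. -/
abbrev cellSigma (X : ∀ j, ℕ → Ω → α j) (C : Set (Fin n × ℕ)) : MeasurableSpace Ω :=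
  ⨆ q ∈ C, MeasurableSpace.comap (X q.1 q.2) inferInstance

theorem cellSigma_mono {C D : Set (Fin n × ℕ)} (h : C ⊆ D) : cellSigma X C ≤ cellSigma X D :=
  biSup_mono h

theorem measurableSet_row (hA : ∀ i, MeasurableSet (A i))
    (hvbl : ∀ i, DependsOn (fun x => x ∈ A i) (vbl i : Set (Fin n)))
    {i : Fin m} {c : Fin n → ℕ} {C : Set (Fin n × ℕ)} (h : ∀ j ∈ vbl i, (j, c j) ∈ C) :
    MeasurableSet[cellSigma X C] {ω | (fun j => X j (c j) ω) ∈ A i} := by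
  rcases isEmpty_or_nonempty Ω with hΩ | ⟨⟨ω₀⟩⟩
  · rw [Set.eq_empty_of_isEmpty {ω | (fun j => X j (c j) ω) ∈ A i}]
    exact @MeasurableSet.empty _ (cellSigma X C)
  have hset : {ω | (fun j => X j (c j) ω) ∈ A i}
      = (fun ω j => if j ∈ vbl i then X j (c j) ω else X j 0 ω₀) ⁻¹' A i := by
    ext ω
    exact (hvbl i (x := fun j => X j (c j) ω)
      (y := fun j => if j ∈ vbl i then X j (c j) ω else X j 0 ω₀)
      fun j hj => by simp [Finset.mem_coe.1 hj]).to_iff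
  rw [hset]
  refine @measurable_pi_iff _ _ _ (cellSigma X C) _ _ |>.2 (fun j => ?_) (hA i)
  by_cases hj : j ∈ vbl i
  · simp only [hj, if_true]
    exact measurable_iff_comap_le.2 (le_iSup₂_of_le (j, c j) (h j hj) le_rfl)
  · simp only [hj, if_false]
    exact @measurable_const _ _ _ (cellSigma X C) _

variable [MeasurableSpace Ω] {P : Measure Ω}

/-- A table of independent samples, where all entries for the variable `j` have law `μ j`. -/
structure IsSampleTable (μ : ∀ j, Measure (α j)) (P : Measure Ω) (X : ∀ j, ℕ → Ω → α j) :
    Prop where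
  measurable : ∀ j k, Measurable (X j k)
  map_eq : ∀ j k, P.map (X j k) = μ j
  indep : iIndepFun (β := fun q : Fin n × ℕ => α q.1) (fun q => X q.1 q.2) P

namespace IsSampleTable

theorem cellSigma_le (hX : IsSampleTable μ P X) (C : Set (Fin n × ℕ)) :
    cellSigma X C ≤ (inferInstance : MeasurableSpace Ω) :=
  iSup₂_le fun q _ => (hX.measurable q.1 q.2).comap_le

theorem indep_cellSigma (hX : IsSampleTable μ P X) {C D : Set (Fin n × ℕ)} (h : Disjoint C D) :
    Indep (cellSigma X C) (cellSigma X D) P := by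
  have h1 := (iIndepFun_iff_iIndep (fun q : Fin n × ℕ => (inferInstance : MeasurableSpace (α q.1)))
    (fun q => X q.1 q.2) P).1 hX.indep
  have h2 : ∀ q : Fin n × ℕ, MeasurableSpace.comap (X q.1 q.2) inferInstance ≤
      (inferInstance : MeasurableSpace Ω) := fun q => (hX.measurable q.1 q.2).comap_le
  exact indep_iSup_of_disjoint h2 h1 h

theorem measurable_row (hX : IsSampleTable μ P X) (c : Fin n → ℕ) :
    Measurable fun ω j => X j (c j) ω :=
  measurable_pi_iff.2 fun j => hX.measurable j (c j)

theorem map_row [IsProbabilityMeasure P] (hX : IsSampleTable μ P X) (c : Fin n → ℕ) :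
    P.map (fun ω j => X j (c j) ω) = Measure.pi μ := by
  have hinj : Function.Injective fun j : Fin n => (j, c j) := fun j j' h => congrArg Prod.fst h
  have h := hX.indep.precomp hinj
  rw [iIndepFun_iff_map_fun_eq_pi_map (fun j => (hX.measurable j (c j)).aemeasurable)] at h
  simp only [hX.map_eq] at h
  exact h

theorem measureReal_row [IsProbabilityMeasure P] (hX : IsSampleTable μ P X) (c : Fin n → ℕ)
    {B : Set (∀ j, α j)} (hB : MeasurableSet B) :
    P.real {ω | (fun j => X j (c j) ω) ∈ B} = (Measure.pi μ).real B := by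
  rw [← hX.map_row c, map_measureReal_apply (hX.measurable_row c) hB]
  rfl

/-- Two overlapping rows of the table that use different entries exactly for the variables
in `S`. -/
theorem sq_measureReal_le [∀ j, IsProbabilityMeasure (μ j)] [IsProbabilityMeasure P]
    (hX : IsSampleTable μ P X) {B : Set (∀ j, α j)} (hB : MeasurableSet B)
    {S : Finset (Fin n)} {c d : Fin n → ℕ} (hS : ∀ j ∈ S, d j ≠ c j) (hnS : ∀ j ∉ S, d j = c j) :
    (Measure.pi μ).real B ^ 2
      ≤ P.real {ω | (fun j => X j (c j) ω) ∈ B ∧ (fun j => X j (d j) ω) ∈ B} := by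
  set e : Fin n → ℕ := fun j => if j ∈ S then d j else c j + 1 with he
  have hec : ∀ j, e j ≠ c j := fun j => by
    by_cases hj : j ∈ S
    · simpa [he, hj] using hS j hj
    · simp [he, hj]
  have hind : IndepFun (fun ω j => X j (c j) ω) (fun ω j => X j (e j) ω) P := by
    have hle : ∀ f : Fin n → ℕ, MeasurableSpace.comap (fun ω j => X j (f j) ω) inferInstance
        ≤ cellSigma X (Set.range fun j => (j, f j)) := fun f =>
      measurable_iff_comap_le.1 <| @measurable_pi_iff _ _ _ (cellSigma X _) _ _ |>.2 fun j =>
        measurable_iff_comap_le.2 (le_iSup₂_of_le (j, f j) (Set.mem_range_self j) le_rfl)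
    rw [IndepFun_iff_Indep]
    refine indep_of_indep_of_le_right (indep_of_indep_of_le_left
      (hX.indep_cellSigma ?_) (hle c)) (hle e)
    rw [Set.disjoint_left]
    rintro _ ⟨j, rfl⟩ ⟨j', h⟩
    simp only [Prod.mk.injEq] at h
    obtain ⟨rfl, h⟩ := h
    exact hec _ h
  have hlaw := (indepFun_iff_map_prod_eq_prod_map_map (hX.measurable_row c).aemeasurable
    (hX.measurable_row e).aemeasurable).1 hind
  rw [hX.map_row, hX.map_row] at hlaw
  have hd : ∀ ω, (fun j => if j ∈ S then X j (e j) ω else X j (c j) ω) = fun j => X j (d j) ω := by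
    intro ω; funext j
    by_cases hj : j ∈ S
    · simp [he, hj]
    · simp [hj, hnS j hj]
  have hmeas : Measurable fun yw : (∀ j, α j) × (∀ j, α j) =>
      fun j => if j ∈ S then yw.2 j else yw.1 j := by
    refine measurable_pi_iff.2 fun j => ?_
    by_cases hj : j ∈ S
    · simp only [hj, if_true]
      exact (measurable_pi_apply j).comp measurable_snd
    · simp only [hj, if_false]
      exact (measurable_pi_apply j).comp measurable_fst
  have hpair : Measurable fun ω => ((fun j => X j (c j) ω), (fun j => X j (e j) ω)) :=
    (hX.measurable_row c).prodMk (hX.measurable_row e)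
  have hmix : ((Measure.pi μ).prod (Measure.pi μ)).map
      (fun yw : (∀ j, α j) × (∀ j, α j) => fun j => if j ∈ S then yw.2 j else yw.1 j)
      = Measure.pi μ := by
    rw [← hlaw, Measure.map_map hmeas hpair]
    have : (fun yw : (∀ j, α j) × (∀ j, α j) => fun j => if j ∈ S then yw.2 j else yw.1 j) ∘
        (fun ω => ((fun j => X j (c j) ω), (fun j => X j (e j) ω))) = fun ω j => X j (d j) ω := by
      funext ω; exact hd ω
    rw [this, hX.map_row]
  have h := sq_measure_le_prod_mix (Measure.pi μ) S hmix hB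
  have hms : MeasurableSet {yw : (∀ j, α j) × (∀ j, α j) | yw.1 ∈ B ∧
      (fun j => if j ∈ S then yw.2 j else yw.1 j) ∈ B} := (measurable_fst hB).inter (hmeas hB)
  rw [← hlaw, Measure.map_apply hpair hms] at h
  have hset : (fun ω => ((fun j => X j (c j) ω), (fun j => X j (e j) ω))) ⁻¹'
      {yw : (∀ j, α j) × (∀ j, α j) | yw.1 ∈ B ∧
        (fun j => if j ∈ S then yw.2 j else yw.1 j) ∈ B}
      = {ω | (fun j => X j (c j) ω) ∈ B ∧ (fun j => X j (d j) ω) ∈ B} := by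
    ext ω
    simp only [Set.mem_preimage, Set.mem_ofPred_eq, hd]
  have h' : (Measure.pi μ) B ^ 2
      ≤ P {ω | (fun j => X j (c j) ω) ∈ B ∧ (fun j => X j (d j) ω) ∈ B} := by
    rw [← hset]; exact h
  rw [measureReal_def, measureReal_def, ← ENNReal.toReal_pow]
  exact ENNReal.toReal_mono (measure_ne_top _ _) h'

/-- The probability that `b` and then `a` hold in consecutive resamplings, but not in the exchanged
order. -/
theorem measureReal_pair_le [∀ j, IsProbabilityMeasure (μ j)] [IsProbabilityMeasure P]
    (hX : IsSampleTable μ P X) (hA : ∀ i, MeasurableSet (A i))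
    (hvbl : ∀ i, DependsOn (fun x => x ∈ A i) (vbl i : Set (Fin n))) (a b : Fin m)
    {c d : Fin n → ℕ} (hS : ∀ j ∈ vbl a ∩ vbl b, d j ≠ c j) (hnS : ∀ j ∉ vbl a ∩ vbl b, d j = c j) :
    P.real {ω | (fun j => X j (c j) ω) ∈ A b ∧ (fun j => X j (d j) ω) ∈ A a ∧
        ¬ ((fun j => X j (c j) ω) ∈ A a ∧ (fun j => X j (d j) ω) ∈ A b)}
      ≤ (Measure.pi μ).real (A a) * (Measure.pi μ).real (A b)
        - (Measure.pi μ).real (A a ∩ A b) ^ 2 := by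
  have hmeas : ∀ (f : Fin n → ℕ) i, MeasurableSet {ω | (fun j => X j (f j) ω) ∈ A i} := fun f i =>
    hX.measurable_row f (hA i)
  have h1 : P.real ({ω | (fun j => X j (d j) ω) ∈ A a} ∩ {ω | (fun j => X j (c j) ω) ∈ A b})
      = (Measure.pi μ).real (A a) * (Measure.pi μ).real (A b) := by
    have hdisj : Disjoint {q : Fin n × ℕ | q.1 ∈ vbl a ∧ q.2 = d q.1}
        {q : Fin n × ℕ | q.1 ∈ vbl b ∧ q.2 = c q.1} := by
      rw [Set.disjoint_left]
      rintro ⟨j, k⟩ ⟨h1, h2⟩ ⟨h3, h4⟩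
      exact hS j (Finset.mem_inter.2 ⟨h1, h3⟩) (h2.symm.trans h4)
    have h := (Indep_iff _ _ P).1 (hX.indep_cellSigma hdisj) _ _
      (measurableSet_row (X := X) hA hvbl (i := a) (c := d) fun j hj => ⟨hj, rfl⟩)
      (measurableSet_row (X := X) hA hvbl (i := b) (c := c) fun j hj => ⟨hj, rfl⟩)
    rw [measureReal_def, h, ENNReal.toReal_mul, ← measureReal_def, ← measureReal_def,
      hX.measureReal_row d (hA a), hX.measureReal_row c (hA b)]
  have h2 := hX.sq_measureReal_le ((hA a).inter (hA b)) hS hnS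
  set E := {ω | (fun j => X j (d j) ω) ∈ A a} ∩ {ω | (fun j => X j (c j) ω) ∈ A b}
  set F := {ω | (fun j => X j (c j) ω) ∈ A a ∩ A b ∧ (fun j => X j (d j) ω) ∈ A a ∩ A b} with hF
  have hFE : F ⊆ E := fun ω hω => ⟨hω.2.1, hω.1.2⟩
  have hFm : MeasurableSet F :=
    ((hmeas c a).inter (hmeas c b)).inter ((hmeas d a).inter (hmeas d b))
  have h3 : {ω | (fun j => X j (c j) ω) ∈ A b ∧ (fun j => X j (d j) ω) ∈ A a ∧
        ¬ ((fun j => X j (c j) ω) ∈ A a ∧ (fun j => X j (d j) ω) ∈ A b)} = E \ F := by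
    ext ω
    simp only [E, F, Set.mem_sdiff, Set.mem_inter_iff, Set.mem_ofPred_eq]
    tauto
  rw [h3, measureReal_sdiff hFE hFm, h1]
  linarith

theorem measureReal_inter_biInter (hX : IsSampleTable μ P X) {I : Finset (Fin m)}
    {C₀ : Set (Fin n × ℕ)} {C : Fin m → Set (Fin n × ℕ)} {D : Set Ω} {E : Fin m → Set Ω}
    (hD : MeasurableSet[cellSigma X C₀] D) (hE : ∀ a ∈ I, MeasurableSet[cellSigma X (C a)] (E a))
    (h₀ : ∀ a ∈ I, Disjoint C₀ (C a)) (hC : ∀ a ∈ I, ∀ b ∈ I, a ≠ b → Disjoint (C a) (C b)) :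
    P.real (D ∩ ⋂ a ∈ I, E a) = P.real D * ∏ a ∈ I, P.real (E a) := by
  induction I using Finset.induction_on generalizing C₀ D with
  | empty => simp
  | insert a I ha ih =>
    have h1 : P.real (D ∩ E a) = P.real D * P.real (E a) := by
      have h := (Indep_iff _ _ P).1 (hX.indep_cellSigma (h₀ a (Finset.mem_insert_self a I))) _ _
        hD (hE a (Finset.mem_insert_self a I))
      rw [measureReal_def, h, ENNReal.toReal_mul]; rfl
    rw [Finset.set_biInter_insert, ← Set.inter_assoc, Finset.prod_insert ha, ← mul_assoc, ← h1]
    refine ih (C₀ := C₀ ∪ C a) ?_ (fun b hb => hE b (Finset.mem_insert_of_mem hb)) ?_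
      (fun b hb b' hb' => hC b (Finset.mem_insert_of_mem hb) b' (Finset.mem_insert_of_mem hb'))
    · exact (cellSigma_mono Set.subset_union_left _ hD).inter
        (cellSigma_mono Set.subset_union_right _ (hE a (Finset.mem_insert_self a I)))
    · intro b hb
      refine Set.disjoint_union_left.2 ⟨h₀ b (Finset.mem_insert_of_mem hb), ?_⟩
      exact hC a (Finset.mem_insert_self a I) b (Finset.mem_insert_of_mem hb)
        (fun h => ha (h ▸ hb))

end IsSampleTable

end Probability

/-! ### Probability that a layered list passes -/

section LayerProbability

open scoped Classical

variable {m n : ℕ} {α : Fin n → Type*}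
  {G : SimpleGraph (Fin m)} {vbl : Fin m → Finset (Fin n)}
  {A : Fin m → Set (∀ j, α j)} {Z : Finset (Fin m)} {π : Fin m → Fin m}
  {p θ : Fin m → ℝ}
  {Ω : Type*} {X : ∀ j, ℕ → Ω → α j}

/-- The event that a list of layers passes on the table `X` and that no pair passes with the order
exchanged. -/
def goodEvent (vbl : Fin m → Finset (Fin n)) (A : Fin m → Set (∀ j, α j))
    (X : ∀ j, ℕ → Ω → α j) (Z : Finset (Fin m)) (π : Fin m → Fin m)
    (L : List (Finset (Fin m))) : Set Ω :=
  {ω | Passes vbl A (fun j k => X j k ω) L ∧ NoSwap vbl A (fun j k => X j k ω) Z π L}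

/-- The entries of the table that are consumed when the events in `s` are resampled. -/
def usedCells (vbl : Fin m → Finset (Fin n)) (s : Multiset (Fin m)) : Set (Fin n × ℕ) :=
  {q | q.2 < useCount vbl s q.1}

theorem useCount_mono {s t : Multiset (Fin m)} (h : s ≤ t) (j : Fin n) :
    useCount vbl s j ≤ useCount vbl t j := Multiset.countP_le_of_le _ h

theorem usedCells_mono {s t : Multiset (Fin m)} (h : s ≤ t) :
    usedCells vbl s ⊆ usedCells vbl t := fun q hq => lt_of_lt_of_le hq (useCount_mono h q.1)

theorem useCount_lt {i : Fin m} {s t : Multiset (Fin m)} (h : i ::ₘ s ≤ t) {j : Fin n}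
    (hj : j ∈ vbl i) : useCount vbl s j < useCount vbl t j := by
  have := useCount_mono (vbl := vbl) h j
  rw [useCount_cons, if_pos hj] at this
  omega

/-- The entries read by `a` in the layer above `J`, and by its partner if that lies in `J`. -/
def blockCells (vbl : Fin m → Finset (Fin n)) (Z : Finset (Fin m)) (π : Fin m → Fin m)
    (J : Finset (Fin m)) (s : Multiset (Fin m)) (a : Fin m) : Set (Fin n × ℕ) :=
  {q | (q.1 ∈ vbl a ∧ q.2 = useCount vbl (J.val + s) q.1) ∨
    ((a ∈ Z ∧ π a ∈ J) ∧ q.1 ∈ vbl (π a) ∧ q.2 = useCount vbl s q.1)}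

/-- The constraint of `goodEvent` on the block formed by `a`, in the layer above `J`, and its
partner if that lies in `J`. -/
def blockEvent (vbl : Fin m → Finset (Fin n)) (A : Fin m → Set (∀ j, α j))
    (X : ∀ j, ℕ → Ω → α j) (Z : Finset (Fin m)) (π : Fin m → Fin m)
    (J : Finset (Fin m)) (s : Multiset (Fin m)) (a : Fin m) : Set Ω :=
  {ω | tableState vbl (fun j k => X j k ω) (J.val + s) ∈ A a ∧ (a ∈ Z → π a ∈ J →
    tableState vbl (fun j k => X j k ω) s ∈ A (π a) ∧
    ¬ (tableState vbl (fun j k => X j k ω) ((J.erase (π a)).val + s) ∈ A a ∧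
      tableState vbl (fun j k => X j k ω) (a ::ₘ ((J.erase (π a)).val + s)) ∈ A (π a)))}

theorem useCount_erase_eq (hG : canonicalDependencyGraph vbl ≤ G) {J : Finset (Fin m)}
    (hJ : G.IsIndepSet (J : Set (Fin m))) {b : Fin m} (hb : b ∈ J) (s : Multiset (Fin m))
    (j : Fin n) :
    useCount vbl ((J.erase b).val + s) j
      = if j ∈ vbl b then useCount vbl s j else useCount vbl (J.val + s) j := by
  split_ifs with hj
  · rw [useCount_add, useCount_eq_zero hG (i := b) ?_ hj, zero_add]
    intro k hk
    have hk' : k ∈ J.erase b := hk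
    have hne := (Finset.ne_of_mem_erase hk').symm
    exact ⟨hne, hJ hb (Finset.mem_of_mem_erase hk') hne⟩
  · have : J.val = b ::ₘ (J.erase b).val := by rw [Finset.erase_val, Multiset.cons_erase hb]
    rw [this, Multiset.cons_add, useCount_cons, if_neg hj, add_zero]

theorem useCount_val_add_of_mem (hG : canonicalDependencyGraph vbl ≤ G) {J : Finset (Fin m)}
    (hJ : G.IsIndepSet (J : Set (Fin m))) {b : Fin m} (hb : b ∈ J) (s : Multiset (Fin m))
    {j : Fin n} (hj : j ∈ vbl b) :
    useCount vbl (J.val + s) j = useCount vbl s j + 1 := by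
  have h := useCount_erase_eq hG hJ hb s j
  have : J.val = b ::ₘ (J.erase b).val := by rw [Finset.erase_val, Multiset.cons_erase hb]
  rw [if_pos hj] at h
  rw [this, Multiset.cons_add, useCount_cons, if_pos hj, h]

theorem goodEvent_cons_subset (I J : Finset (Fin m)) (L : List (Finset (Fin m)))
    (B : Finset (Fin m)) :
    goodEvent vbl A X Z π (I :: J :: L) ⊆
      goodEvent vbl A X Z π ((J \ B) :: L) ∩ ⋂ a ∈ I, blockEvent vbl A X Z π J (layerMult L) a := by
  rintro ω ⟨⟨h1, h2, h3⟩, h4, h5⟩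
  refine ⟨⟨⟨fun i hi => h2 i (Finset.mem_sdiff.1 hi).1, h3⟩, ?_⟩, ?_⟩
  · cases L with
    | nil => trivial
    | cons K L => exact ⟨fun a ha => h5.1 a (Finset.mem_sdiff.1 ha).1, h5.2⟩
  · simp only [Set.mem_iInter]
    exact fun a ha => ⟨h1 a ha, fun haZ hb => ⟨h2 _ hb, h4 a ha haZ hb⟩⟩

variable [∀ j, MeasurableSpace (α j)] {μ : ∀ j, Measure (α j)}

theorem measurableSet_tableState
    (hA : ∀ i, MeasurableSet (A i))
    (hvbl : ∀ i, DependsOn (fun x => x ∈ A i) (vbl i : Set (Fin n)))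
    {i : Fin m} {s t : Multiset (Fin m)} (h : i ::ₘ s ≤ t) :
    MeasurableSet[cellSigma X (usedCells vbl t)]
      {ω | tableState vbl (fun j k => X j k ω) s ∈ A i} :=
  measurableSet_row hA hvbl fun _ hj => useCount_lt h hj

theorem measurableSet_goodEvent
    (hA : ∀ i, MeasurableSet (A i))
    (hvbl : ∀ i, DependsOn (fun x => x ∈ A i) (vbl i : Set (Fin n)))
    (L : List (Finset (Fin m))) :
    MeasurableSet[cellSigma X (usedCells vbl (layerMult L))] (goodEvent vbl A X Z π L) := by
  induction L with
  | nil =>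
    convert @MeasurableSet.univ _ (cellSigma X (usedCells vbl (layerMult [])))
    exact Set.eq_univ_of_forall fun ω => ⟨trivial, trivial⟩
  | cons I L ih =>
    have hmono := cellSigma_mono (X := X) (usedCells_mono (vbl := vbl)
      (show layerMult L ≤ layerMult (I :: L) from Multiset.le_add_left _ _))
    have h1 : MeasurableSet[cellSigma X (usedCells vbl (layerMult (I :: L)))]
        (⋂ i ∈ I, {ω | tableState vbl (fun j k => X j k ω) (layerMult L) ∈ A i}) := by
      refine Finset.measurableSet_biInter I fun i hi => measurableSet_tableState hA hvbl ?_
      rw [layerMult_cons, ← Multiset.singleton_add]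
      exact add_le_add_left (Multiset.singleton_le.2 hi) _
    cases L with
    | nil =>
      convert h1 using 1
      ext ω
      simp [goodEvent, Passes, NoSwap]
    | cons J L =>
      have h2 : MeasurableSet[cellSigma X (usedCells vbl (layerMult (I :: J :: L)))]
          (⋂ a ∈ I.filter (fun a => a ∈ Z ∧ π a ∈ J),
            ({ω | tableState vbl (fun j k => X j k ω) ((J.erase (π a)).val + layerMult L) ∈ A a} ∩
             {ω | tableState vbl (fun j k => X j k ω) (a ::ₘ ((J.erase (π a)).val + layerMult L))
                ∈ A (π a)})ᶜ) := by
        refine Finset.measurableSet_biInter _ fun a ha => MeasurableSet.compl (MeasurableSet.inter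
          (measurableSet_tableState hA hvbl ?_) (measurableSet_tableState hA hvbl ?_))
        all_goals
          obtain ⟨haI, haZ, hb⟩ := Finset.mem_filter.1 ha
          have hJ : J.val = {π a} + (J.erase (π a)).val := by
            rw [Finset.erase_val, Multiset.singleton_add, Multiset.cons_erase hb]
          have hI : ({a} : Multiset (Fin m)) ≤ I.val := Multiset.singleton_le.2 haI
          simp only [layerMult_cons, ← Multiset.singleton_add]
        · refine add_le_add hI (add_le_add_left ?_ _)
          rw [hJ]; exact Multiset.le_add_left _ _
        · rw [hJ]
          calc ({π a} : Multiset (Fin m)) + ({a} + ((J.erase (π a)).val + layerMult L))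
              = {a} + ({π a} + (J.erase (π a)).val + layerMult L) := by abel
            _ ≤ _ := add_le_add_left hI _
      convert (h1.inter h2).inter (hmono _ ih) using 1
      ext ω
      simp only [goodEvent, Passes, NoSwap, NoSwapAt, Set.mem_inter_iff, Set.mem_iInter,
        Set.mem_ofPred_eq, Set.mem_compl_iff, Finset.mem_filter]
      constructor
      · rintro ⟨⟨h1, h2⟩, h3, h4⟩
        exact ⟨⟨h1, fun a ha => h3 a ha.1 ha.2.1 ha.2.2⟩, h2, h4⟩
      · rintro ⟨⟨h1, h3⟩, h2, h4⟩
        exact ⟨⟨h1, h2⟩, fun a h h' h'' => h3 a ⟨h, h', h''⟩, h4⟩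

theorem measurableSet_blockEvent (hA : ∀ i, MeasurableSet (A i))
    (hvbl : ∀ i, DependsOn (fun x => x ∈ A i) (vbl i : Set (Fin n)))
    (hG : canonicalDependencyGraph vbl ≤ G) {J : Finset (Fin m)}
    (hJ : G.IsIndepSet (J : Set (Fin m))) (s : Multiset (Fin m)) (a : Fin m) :
    MeasurableSet[cellSigma X (blockCells vbl Z π J s a)] (blockEvent vbl A X Z π J s a) := by
  have h1 : MeasurableSet[cellSigma X (blockCells vbl Z π J s a)]
      {ω | tableState vbl (fun j k => X j k ω) (J.val + s) ∈ A a} :=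
    measurableSet_row hA hvbl fun j hj => Or.inl ⟨hj, rfl⟩
  by_cases hab : a ∈ Z ∧ π a ∈ J
  · have h2 : MeasurableSet[cellSigma X (blockCells vbl Z π J s a)]
        {ω | tableState vbl (fun j k => X j k ω) s ∈ A (π a)} :=
      measurableSet_row hA hvbl fun j hj => Or.inr ⟨hab, hj, rfl⟩
    have h3 : MeasurableSet[cellSigma X (blockCells vbl Z π J s a)]
        {ω | tableState vbl (fun j k => X j k ω) ((J.erase (π a)).val + s) ∈ A a} := by
      refine measurableSet_row hA hvbl fun j hj => ?_
      rw [useCount_erase_eq hG hJ hab.2]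
      split_ifs with hb
      · exact Or.inr ⟨hab, hb, rfl⟩
      · exact Or.inl ⟨hj, rfl⟩
    have h4 : MeasurableSet[cellSigma X (blockCells vbl Z π J s a)]
        {ω | tableState vbl (fun j k => X j k ω) (a ::ₘ ((J.erase (π a)).val + s)) ∈ A (π a)} := by
      refine measurableSet_row hA hvbl fun j hj => ?_
      rw [useCount_cons, useCount_erase_eq hG hJ hab.2, if_pos hj]
      split_ifs with ha
      · exact Or.inl ⟨ha, (useCount_val_add_of_mem hG hJ hab.2 s hj).symm⟩
      · exact Or.inr ⟨hab, hj, rfl⟩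
    convert h1.inter (h2.inter (h3.inter h4).compl) using 1
    ext ω
    simp only [blockEvent, hab, Set.mem_inter_iff, Set.mem_ofPred_eq, Set.mem_compl_iff,
      forall_true_left]
  · convert h1 using 1
    ext ω
    simp only [blockEvent, Set.mem_ofPred_eq, and_iff_left_iff_imp]
    exact fun _ h h' => absurd ⟨h, h'⟩ hab

variable [MeasurableSpace Ω] {P : Measure Ω}

theorem measureReal_blockEvent_le [∀ j, IsProbabilityMeasure (μ j)] [IsProbabilityMeasure P]
    (hX : IsSampleTable μ P X) (hA : ∀ i, MeasurableSet (A i))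
    (hvbl : ∀ i, DependsOn (fun x => x ∈ A i) (vbl i : Set (Fin n)))
    (hG : canonicalDependencyGraph vbl ≤ G) (hp : ∀ i, (Measure.pi μ).real (A i) = p i)
    (hθ : ∀ a ∈ Z, p a * p (π a) * θ a ≤ (Measure.pi μ).real (A a ∩ A (π a)) ^ 2)
    {J : Finset (Fin m)} (hJ : G.IsIndepSet (J : Set (Fin m))) (s : Multiset (Fin m)) (a : Fin m) :
    P.real (blockEvent vbl A X Z π J s a)
      ≤ p a * if a ∈ Z ∧ π a ∈ J then p (π a) * (1 - θ a) else 1 := by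
  split_ifs with hab
  · set b := π a with hb
    -- `c` is read by whichever of `a`, `b` comes first, `d` by the other one.
    set c : Fin n → ℕ := fun j => if j ∈ vbl b then useCount vbl s j
      else useCount vbl (J.val + s) j with hc
    set d : Fin n → ℕ := fun j => if j ∈ vbl a ∩ vbl b then c j + 1 else c j with hd
    have h := hX.measureReal_pair_le hA hvbl a b (c := c) (d := d)
      (fun j hj => by simp only [hd, if_pos hj]; omega) (fun j hj => by simp only [hd, if_neg hj])
    rw [hp, hp] at h
    have hsub : blockEvent vbl A X Z π J s a ⊆
        {ω | (fun j => X j (c j) ω) ∈ A b ∧ (fun j => X j (d j) ω) ∈ A a ∧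
          ¬ ((fun j => X j (c j) ω) ∈ A a ∧ (fun j => X j (d j) ω) ∈ A b)} := by
      intro ω hω
      obtain ⟨h1, h2⟩ := hω
      obtain ⟨h2, h3⟩ := h2 hab.1 hab.2
      have congr_row : ∀ {i : Fin m} {f g : Fin n → ℕ}, (∀ j ∈ vbl i, f j = g j) →
          (fun j => X j (f j) ω) ∈ A i → (fun j => X j (g j) ω) ∈ A i := by
        intro i f g hfg hf
        exact (hvbl i (x := fun j => X j (f j) ω) (y := fun j => X j (g j) ω)
          fun j hj => by simp only [hfg j hj]).mp hf
      refine ⟨congr_row (fun j hj => ?_) h2, congr_row (fun j hj => ?_) h1, fun h4 => h3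
        ⟨congr_row (fun j hj => ?_) h4.1, congr_row (fun j hj => ?_) h4.2⟩⟩
      · simp only [hc, if_pos hj]
      · by_cases hjb : j ∈ vbl b
        · simp only [hd, hc, Finset.mem_inter, hj, hjb, and_self, if_true]
          exact useCount_val_add_of_mem hG hJ hab.2 s hjb
        · simp only [hd, hc, Finset.mem_inter, hjb, and_false, if_false]
      · rw [useCount_erase_eq hG hJ hab.2]
      · have hjb : j ∈ vbl b := hj
        rw [useCount_cons, useCount_erase_eq hG hJ hab.2, if_pos hj]
        by_cases hja : j ∈ vbl a
        · simp only [hd, hc, Finset.mem_inter, hjb, hja, and_self, if_true]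
        · simp only [hd, hc, Finset.mem_inter, hjb, hja, false_and, if_false, if_true, add_zero]
    have h5 := measureReal_mono (μ := P) hsub
    have h6 := hθ a hab.1
    rw [← hb] at h6
    nlinarith
  · rw [mul_one, ← hp a, ← hX.measureReal_row (useCount vbl (J.val + s)) (hA a)]
    exact measureReal_mono fun ω hω => hω.1

/-- One layer of the bound on `goodEvent`: the blocks of `I` are independent of everything below
that avoids the partners in `J`. -/
theorem measureReal_inter_blockEvent_le [∀ j, IsProbabilityMeasure (μ j)] [IsProbabilityMeasure P]
    (hX : IsSampleTable μ P X) (hA : ∀ i, MeasurableSet (A i))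
    (hvbl : ∀ i, DependsOn (fun x => x ∈ A i) (vbl i : Set (Fin n)))
    (hG : canonicalDependencyGraph vbl ≤ G) (hp : ∀ i, (Measure.pi μ).real (A i) = p i)
    (hθ : ∀ a ∈ Z, p a * p (π a) * θ a ≤ (Measure.pi μ).real (A a ∩ A (π a)) ^ 2)
    (hπ : Set.InjOn π Z)
    {I J : Finset (Fin m)} (hI : G.IsIndepSet (I : Set (Fin m)))
    (hJ : G.IsIndepSet (J : Set (Fin m))) (s : Multiset (Fin m)) {D : Set Ω}
    (hD : MeasurableSet[cellSigma X (usedCells vbl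
      ((J \ (I.filter (fun a => a ∈ Z ∧ π a ∈ J)).image π).val + s))] D) :
    P.real (D ∩ ⋂ a ∈ I, blockEvent vbl A X Z π J s a)
      ≤ P.real D * ((∏ i ∈ I, p i) * pairPenalty Z π θ I J
        * ∏ b ∈ (I.filter (fun a => a ∈ Z ∧ π a ∈ J)).image π, p b) := by
  set B := (I.filter (fun a => a ∈ Z ∧ π a ∈ J)).image π with hB
  have hnotmem : ∀ {S : Finset (Fin m)}, G.IsIndepSet (S : Set (Fin m)) → ∀ {a b : Fin m},
      a ∈ S → b ∈ S → a ≠ b → ∀ {j}, j ∈ vbl a → j ∉ vbl b := fun hS _ _ ha hb hne _ hj =>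
    disjoint_vbl hG hne (hS ha hb hne) hj
  rw [hX.measureReal_inter_biInter hD
    (fun a _ => measurableSet_blockEvent hA hvbl hG hJ s a) ?_ ?_]
  · refine mul_le_mul_of_nonneg_left ?_ measureReal_nonneg
    have e1 : (∏ i ∈ I, p i) * pairPenalty Z π θ I J * ∏ b ∈ B, p b
        = ∏ a ∈ I, (p a * if a ∈ Z ∧ π a ∈ J then p (π a) * (1 - θ a) else 1) := by
      rw [Finset.prod_mul_distrib, ← Finset.prod_filter, Finset.prod_mul_distrib, hB,
        Finset.prod_image fun a ha b hb => hπ (Finset.mem_filter.1 ha).2.1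
          (Finset.mem_filter.1 hb).2.1, pairPenalty]
      ring
    rw [e1]
    exact Finset.prod_le_prod (fun a _ => measureReal_nonneg)
      fun a _ => measureReal_blockEvent_le hX hA hvbl hG hp hθ hJ s a
  · intro a ha
    rw [Set.disjoint_left]
    rintro ⟨j, k⟩ h1 (⟨_, h3⟩ | ⟨hab, h2, h3⟩)
    · have : useCount vbl ((J \ B).val + s) j ≤ useCount vbl (J.val + s) j :=
        useCount_mono (Multiset.add_le_add_right (Finset.val_le_iff.2 Finset.sdiff_subset)) j
      simp only [usedCells, Set.mem_ofPred_eq] at h1 h3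
      omega
    · have h4 : useCount vbl ((J \ B).val) j = 0 := by
        refine useCount_eq_zero hG (i := π a) (fun c hc => ?_) h2
        have hc' : c ∈ J \ B := hc
        obtain ⟨hcJ, hcB⟩ := Finset.mem_sdiff.1 hc'
        have hne : π a ≠ c := fun h => hcB (h ▸ Finset.mem_image_of_mem π
          (Finset.mem_filter.2 ⟨ha, hab⟩))
        exact ⟨hne, hJ hab.2 hcJ hne⟩
      simp only [usedCells, Set.mem_ofPred_eq, useCount_add, h4] at h1 h3
      omega
  · intro a ha a' ha' hne
    rw [Set.disjoint_left]
    rintro ⟨j, k⟩ (⟨h1, h2⟩ | ⟨hab, h1, h2⟩) (⟨h3, h4⟩ | ⟨hab', h3, h4⟩)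
    · exact hnotmem hI ha ha' hne h1 h3
    · have := useCount_val_add_of_mem hG hJ hab'.2 s h3
      have e2 : k = useCount vbl (J.val + s) j := h2
      have e4 : k = useCount vbl s j := h4
      omega
    · have := useCount_val_add_of_mem hG hJ hab.2 s h1
      have e2 : k = useCount vbl s j := h2
      have e4 : k = useCount vbl (J.val + s) j := h4
      omega
    · exact hnotmem hJ hab.2 hab'.2 (fun h => hne (hπ hab.1 hab'.1 h)) h1 h3

theorem measureReal_goodEvent_le [∀ j, IsProbabilityMeasure (μ j)] [IsProbabilityMeasure P]
    (hX : IsSampleTable μ P X) (hA : ∀ i, MeasurableSet (A i))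
    (hvbl : ∀ i, DependsOn (fun x => x ∈ A i) (vbl i : Set (Fin n)))
    (hG : canonicalDependencyGraph vbl ≤ G) (hp : ∀ i, (Measure.pi μ).real (A i) = p i)
    (hθ : ∀ a ∈ Z, p a * p (π a) * θ a ≤ (Measure.pi μ).real (A a ∩ A (π a)) ^ 2)
    (hθ1 : ∀ a ∈ Z, θ a ≤ 1)
    (hπ : Set.InjOn π Z) (hπZ : ∀ a ∈ Z, π a ∉ Z) {L : List (Finset (Fin m))}
    (hL : ∀ I ∈ L, G.IsIndepSet (I : Set (Fin m))) :
    P.real (goodEvent vbl A X Z π L) ≤ layerWeight p Z π θ L := by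
  have hp0 : ∀ i, 0 ≤ p i := fun i => hp i ▸ measureReal_nonneg
  cases L with
  | nil => exact measureReal_le_one
  | cons I L =>
    induction L generalizing I with
    | nil =>
      have h := measureReal_inter_blockEvent_le (J := ∅) (D := Set.univ) hX hA hvbl hG hp hθ hπ
        (hL I (by simp)) (by simp [SimpleGraph.IsIndepSet]) 0 MeasurableSet.univ
      simp only [Finset.notMem_empty, and_false, Finset.filter_false, Finset.image_empty,
        Finset.prod_empty, mul_one, probReal_univ, one_mul, Set.univ_inter] at h
      refine le_trans (measureReal_mono ?_) (h.trans (le_of_eq ?_))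
      · intro ω hω
        simp only [Set.mem_iInter]
        exact fun a ha => ⟨hω.1.1 a ha, fun _ hb => absurd hb (Finset.notMem_empty _)⟩
      · simp [layerWeight]
    | cons J L ih =>
      set B := (I.filter (fun a => a ∈ Z ∧ π a ∈ J)).image π with hB
      have hJ : G.IsIndepSet (J : Set (Fin m)) := hL J (by simp)
      have hBJ : B ⊆ J := by
        intro b hb
        obtain ⟨a, ha, rfl⟩ := Finset.mem_image.1 hb
        exact (Finset.mem_filter.1 ha).2.2
      have hBZ : ∀ b ∈ B, b ∉ Z := by
        intro b hb
        obtain ⟨a, ha, rfl⟩ := Finset.mem_image.1 hb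
        exact hπZ a (Finset.mem_filter.1 ha).2.1
      have h1 := measureReal_inter_blockEvent_le hX hA hvbl hG hp hθ hπ (hL I (by simp)) hJ
        (layerMult L) (measurableSet_goodEvent (X := X) (Z := Z) (π := π) hA hvbl ((J \ B) :: L))
      have h2 := ih (J \ B) (fun K hK => by
        rcases List.mem_cons.1 hK with rfl | hK
        · exact hJ.mono (by simp)
        · exact hL K (by simp [hK]))
      refine (measureReal_mono (goodEvent_cons_subset I J L B)).trans (h1.trans ?_)
      -- Vertices of `B` are not in `Z`, so removing them from `J` only removes their weight `p`.
      have h3 : pairPenalty Z π θ (J \ B) (L.headD ∅) = pairPenalty Z π θ J (L.headD ∅) := by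
        unfold pairPenalty
        refine Finset.prod_congr ?_ fun _ _ => rfl
        ext a
        simp only [Finset.mem_filter, Finset.mem_sdiff]
        exact ⟨fun h => ⟨h.1.1, h.2⟩, fun h => ⟨⟨h.1, fun hb => hBZ a hb h.2.1⟩, h.2⟩⟩
      have h4 : layerWeight p Z π θ (J :: L)
          = (∏ b ∈ B, p b) * layerWeight p Z π θ ((J \ B) :: L) := by
        simp only [layerWeight, h3]
        rw [← Finset.prod_sdiff hBJ]
        ring
      calc _ ≤ layerWeight p Z π θ ((J \ B) :: L) * ((∏ i ∈ I, p i) * pairPenalty Z π θ I J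
            * ∏ b ∈ B, p b) := by
            refine mul_le_mul_of_nonneg_right h2 (mul_nonneg (mul_nonneg ?_ ?_) ?_)
            · exact Finset.prod_nonneg fun i _ => hp0 i
            · exact pairPenalty_nonneg hθ1 _ _
            · exact Finset.prod_nonneg fun i _ => hp0 i
        _ = layerWeight p Z π θ (I :: J :: L) := by
            have h5 : layerWeight p Z π θ (I :: J :: L)
                = (∏ i ∈ I, p i) * pairPenalty Z π θ I J * layerWeight p Z π θ (J :: L) := rfl
            rw [h5, h4]
            ring

end LayerProbability

/-! ### The expected number of steps -/

section Main

open scoped Classical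

variable {m n : ℕ} {G : SimpleGraph (Fin m)}

/-- Exchanging mass along the edges of a matching one by one: some choice `Z` of one endpoint of
each edge allows to move the mass `t` from that endpoint to the other one within Shearer's bound. -/
theorem ShearerPos.exists_orientation {r t : Fin m → ℝ} (hr : ShearerPos G r)
    {W : Finset (Fin m)} {π : Fin m → Fin m} (hW : ∀ i ∈ W, π i ∈ W) (hππ : ∀ i ∈ W, π (π i) = i)
    (hadj : ∀ i ∈ W, G.Adj i (π i)) (ht : ∀ i ∈ W, t (π i) = t i) (ht0 : ∀ i ∈ W, 0 ≤ t i)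
    (htr : ∀ i ∈ W, t i ≤ r i) :
    ∃ Z ⊆ W, (∀ i ∈ W, i ∈ Z ↔ π i ∉ Z) ∧
      ShearerPos G (fun i => if i ∈ Z then r i - t i else if i ∈ W then r i + t i else r i) := by
  have key : ∀ U ⊆ W, ∃ Z D : Finset (Fin m), Z ⊆ D ∧ U ⊆ D ∧ D ⊆ W ∧ (∀ i ∈ D, π i ∈ D) ∧
      (∀ i ∈ D, i ∈ Z ↔ π i ∉ Z) ∧
      ShearerPos G (fun i => if i ∈ Z then r i - t i else if i ∈ D then r i + t i else r i) := by
    intro U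
    induction U using Finset.induction_on with
    | empty =>
      intro _
      exact ⟨∅, ∅, by simp, by simp, by simp, by simp, by simp, by simpa using hr⟩
    | insert u U _ ih =>
      intro hUW
      obtain ⟨Z, D, hZD, hUD, hDW, hD, hor, hpos⟩ := ih ((Finset.subset_insert _ _).trans hUW)
      by_cases huD : u ∈ D
      · exact ⟨Z, D, hZD, Finset.insert_subset huD hUD, hDW, hD, hor, hpos⟩
      have huW : u ∈ W := hUW (Finset.mem_insert_self u U)
      have hvD : π u ∉ D := fun h => huD (hππ u huW ▸ hD _ h)
      have huZ : u ∉ Z := fun h => huD (hZD h)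
      have hvZ : π u ∉ Z := fun h => hvD (hZD h)
      have hne : u ≠ π u := (hadj u huW).ne
      have htv := htr _ (hW u huW)
      rw [ht u huW] at htv
      have hDne : ∀ i ∈ D, i ≠ u ∧ i ≠ π u ∧ π i ≠ u ∧ π i ≠ π u := fun i hi =>
        ⟨fun h => huD (h ▸ hi), fun h => hvD (h ▸ hi), fun h => huD (h ▸ hD i hi),
          fun h => hvD (h ▸ hD i hi)⟩
      have hD' : ∀ i ∈ insert u (insert (π u) D), π i ∈ insert u (insert (π u) D) := by
        intro i hi
        simp only [Finset.mem_insert] at hi ⊢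
        rcases hi with rfl | rfl | hi
        · exact Or.inr (Or.inl rfl)
        · exact Or.inl (hππ u huW)
        · exact Or.inr (Or.inr (hD i hi))
      have hUD' : insert u U ⊆ insert u (insert (π u) D) :=
        Finset.insert_subset_insert _ (hUD.trans (Finset.subset_insert _ _))
      have hDW' : insert u (insert (π u) D) ⊆ W :=
        Finset.insert_subset huW (Finset.insert_subset (hW u huW) hDW)
      rcases hpos.exchange (hadj u huW) (ht0 u huW) (by simpa [huZ, huD] using htr u huW)
        (by simpa [hvZ, hvD] using htv) with h | h
      · refine ⟨insert u Z, _, Finset.insert_subset_insert _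
          (hZD.trans (Finset.subset_insert _ _)), hUD', hDW', hD', ?_, ?_⟩
        · intro i hi
          simp only [Finset.mem_insert] at hi
          rcases hi with rfl | rfl | hi
          · simp [hne.symm, hvZ]
          · simp [hππ u huW, hne.symm, hvZ]
          · obtain ⟨h1, _, h3, _⟩ := hDne i hi
            simpa [h1, h3] using hor i hi
        · convert h using 1
          funext i
          by_cases hi : i = π u
          · subst hi; simp [hne.symm, hvZ, hvD, ht u huW]
          · rw [Function.update_of_ne hi]
            by_cases hi' : i = u
            · subst hi'; simp [huZ, huD]
            · rw [Function.update_of_ne hi']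
              simp [hi, hi']
      · refine ⟨insert (π u) Z, _, (Finset.insert_subset_insert _ hZD).trans
          (Finset.subset_insert _ _), hUD', hDW', hD', ?_, ?_⟩
        · intro i hi
          simp only [Finset.mem_insert] at hi
          rcases hi with rfl | rfl | hi
          · simp [hne, huZ]
          · simp [hππ u huW, hne, huZ]
          · obtain ⟨_, h2, _, h4⟩ := hDne i hi
            simpa [h2, h4] using hor i hi
        · convert h using 1
          funext i
          by_cases hi : i = π u
          · subst hi; simp [hvZ, hvD, ht u huW]
          · rw [Function.update_of_ne hi]
            by_cases hi' : i = u
            · subst hi'; simp [huZ, huD, hne]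
            · rw [Function.update_of_ne hi']
              simp [hi, hi']
  obtain ⟨Z, D, hZD, hWD, hDW, _, hor, hpos⟩ := key W le_rfl
  obtain rfl := Finset.Subset.antisymm hDW hWD
  exact ⟨Z, hZD, hor, hpos⟩

theorem IsLayered.isIndepSet {L : List (Finset (Fin m))} (h : IsLayered G L) :
    ∀ I ∈ L, G.IsIndepSet (I : Set (Fin m)) := by
  obtain ⟨i, L', rfl, hc⟩ := h
  have key : ∀ (K : Finset (Fin m)) (L : List (Finset (Fin m))),
      List.IsChain (LayerStep G) (K :: L) → ∀ I ∈ L, G.IsIndepSet (I : Set (Fin m)) := by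
    intro K L
    induction L generalizing K with
    | nil => simp
    | cons J L ih =>
      intro h I hI
      rw [List.isChain_cons_cons] at h
      rcases List.mem_cons.1 hI with rfl | hI
      · exact h.1.2.1
      · exact ih J h.2 I hI
  intro I hI
  rcases List.mem_cons.1 hI with rfl | hI
  · simp [SimpleGraph.IsIndepSet]
  · exact key _ _ hc I hI

/-- The expected number of steps is at most the total weight of the layered lists. -/
theorem MoserTardosRun.lintegral_steps_le {α : Fin n → Type*} [∀ j, MeasurableSpace (α j)]
    {μ : ∀ j, Measure (α j)} [∀ j, IsProbabilityMeasure (μ j)]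
    {vbl : Fin m → Finset (Fin n)} {A : Fin m → Set (∀ j, α j)}
    (hA : ∀ i, MeasurableSet (A i))
    (hvbl : ∀ i, DependsOn (fun x => x ∈ A i) (vbl i : Set (Fin n)))
    (hG : canonicalDependencyGraph vbl ≤ G) {p θ : Fin m → ℝ}
    (hp : ∀ i, (Measure.pi μ).real (A i) = p i) {Z : Finset (Fin m)} {π : Fin m → Fin m}
    (hθ : ∀ a ∈ Z, p a * p (π a) * θ a ≤ (Measure.pi μ).real (A a ∩ A (π a)) ^ 2)
    (hθ1 : ∀ a ∈ Z, θ a ≤ 1) (hπ : Set.InjOn π Z) (hπZ : ∀ a ∈ Z, π a ∉ Z)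
    (hadj : ∀ a ∈ Z, G.Adj a (π a))
    {Ω : Type*} [MeasurableSpace Ω] {P : Measure Ω} [IsProbabilityMeasure P]
    (R : MoserTardosRun μ vbl A P) :
    ∫⁻ ω, (R.steps ω : ℝ≥0∞) ∂P
      ≤ ∑' L : {L // IsLayered G L}, ENNReal.ofReal (layerWeight p Z π θ L) := by
  have hX : IsSampleTable μ P R.sample := ⟨R.measurable_sample, R.map_sample, R.indep_sample⟩
  have hmeas : ∀ L, MeasurableSet (goodEvent vbl A R.sample Z π L) := fun L =>
    hX.cellSigma_le _ _ (measurableSet_goodEvent hA hvbl L)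
  have hpoint : ∀ ω, (R.steps ω : ℝ≥0∞)
      ≤ ∑' L : {L // IsLayered G L}, (goodEvent vbl A R.sample Z π L.1).indicator 1 ω := by
    intro ω
    set T : Set {L // IsLayered G L} := {L | ω ∈ goodEvent vbl A R.sample Z π L.1} with hT
    have h1 : R.steps ω ≤ T.encard := by
      refine (encard_steps_le (x := fun j k => R.sample j k ω) hG hvbl hadj hπZ
        fun t i => R.holds_of_pick_eq_some t ω i).trans ?_
      rw [← Subtype.val_injective.encard_image T]
      refine Set.encard_le_encard ?_
      rintro L ⟨h2, h3⟩
      exact ⟨⟨L, h2⟩, h3, rfl⟩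
    have h2 : ∑' L : {L // IsLayered G L}, (goodEvent vbl A R.sample Z π L.1).indicator 1 ω
        = (T.encard : ℝ≥0∞) := by
      rw [← ENNReal.tsum_set_one, tsum_subtype T (fun _ => (1 : ℝ≥0∞))]
      rfl
    rw [h2]
    exact ENat.toENNReal_le.2 h1
  calc ∫⁻ ω, (R.steps ω : ℝ≥0∞) ∂P
      ≤ ∫⁻ ω, ∑' L : {L // IsLayered G L},
          (goodEvent vbl A R.sample Z π L.1).indicator 1 ω ∂P := lintegral_mono hpoint
    _ = ∑' L : {L // IsLayered G L}, P (goodEvent vbl A R.sample Z π L.1) := by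
        rw [lintegral_tsum (f := fun (L : {L // IsLayered G L}) ω =>
          (goodEvent vbl A R.sample Z π L.1).indicator (1 : Ω → ℝ≥0∞) ω)
          fun L => (measurable_one.indicator (hmeas L.1)).aemeasurable]
        exact tsum_congr fun L => lintegral_indicator_one (hmeas L.1)
    _ ≤ _ := by
        refine ENNReal.tsum_le_tsum fun L => ?_
        rw [← ENNReal.ofReal_toReal (measure_ne_top P (goodEvent vbl A R.sample Z π L.1))]
        exact ENNReal.ofReal_le_ofReal
          (measureReal_goodEvent_le hX hA hvbl hG hp hθ hθ1 hπ hπZ L.2.isIndepSet)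

end Main

theorem theorem1p4 {m n : ℕ} {α : Fin n → Type*} [∀ j, MeasurableSpace (α j)]
    (μ : ∀ j, Measure (α j)) [∀ j, IsProbabilityMeasure (μ j)]
    (vbl : Fin m → Finset (Fin n)) (A : Fin m → Set (∀ j, α j))
    (hA : ∀ i, MeasurableSet (A i))
    (hvbl : ∀ i, DependsOn (fun x => x ∈ A i) (vbl i : Set (Fin n)))
    (G : SimpleGraph (Fin m)) (hG : canonicalDependencyGraph vbl ≤ G)
    (p : Fin m → ℝ) (hp : ∀ i, (Measure.pi μ).real (A i) = p i)
    (M : G.Subgraph) (hM : M.IsMatching)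
    (δ : Sym2 (Fin m) → ℝ)
    (hδ : ∀ i i', M.Adj i i' →
      δ s(i, i') ∈ Set.Ioo (0 : ℝ) 1 ∧ δ s(i, i') ≤ (Measure.pi μ).real (A i ∩ A i'))
    (ε : ℝ) (hε : 0 < ε)
    (hS : InShearerBound G (fun i => (1 + ε) * pMinus M δ p i))
    {Ω : Type*} [MeasurableSpace Ω] (P : Measure Ω) [IsProbabilityMeasure P]
    (R : MoserTardosRun μ vbl A P) :
    ∫⁻ ω, (R.steps ω : ℝ≥0∞) ∂P ≤ ENNReal.ofReal (m / ε) := by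
  classical
  set π : Fin m → Fin m := fun i => if h : ∃ i', M.Adj i i' then h.choose else i with hπdef
  set W : Finset (Fin m) := Finset.univ.filter (fun i => ∃ i', M.Adj i i') with hWdef
  have hWadj : ∀ i ∈ W, M.Adj i (π i) := by
    intro i hi
    have h : ∃ i', M.Adj i i' := (Finset.mem_filter.1 hi).2
    simp only [hπdef, dif_pos h]
    exact h.choose_spec
  have hmemW : ∀ {i j}, M.Adj i j → i ∈ W := fun h =>
    Finset.mem_filter.2 ⟨Finset.mem_univ _, _, h⟩
  have huniq : ∀ {i j}, M.Adj i j → π i = j := fun {i j} h =>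
    (hM (M.edge_vert h)).unique (hWadj i (hmemW h)) h
  have hπW : ∀ i ∈ W, π i ∈ W := fun i hi => hmemW (hWadj i hi).symm
  have hππ : ∀ i ∈ W, π (π i) = i := fun i hi => huniq (hWadj i hi).symm
  set d : Fin m → ℝ := fun i => δ s(i, π i) with hd
  have hdπ : ∀ i ∈ W, d (π i) = d i := fun i hi => by
    simp only [hd, hππ i hi]; rw [Sym2.eq_swap]
  have hd0 : ∀ i ∈ W, 0 < d i := fun i hi => (hδ _ _ (hWadj i hi)).1.1
  have hd1 : ∀ i ∈ W, d i < 1 := fun i hi => (hδ _ _ (hWadj i hi)).1.2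
  have hdinter : ∀ i ∈ W, d i ≤ (Measure.pi μ).real (A i ∩ A (π i)) := fun i hi =>
    (hδ _ _ (hWadj i hi)).2
  have hdp : ∀ i ∈ W, d i ≤ p i := fun i hi =>
    (hdinter i hi).trans (hp i ▸ measureReal_mono Set.inter_subset_left)
  have hdp' : ∀ i ∈ W, d i ≤ p (π i) := fun i hi => hdπ i hi ▸ hdp (π i) (hπW i hi)
  have hp0 : ∀ i, 0 ≤ p i := fun i => hp i ▸ measureReal_nonneg
  have hpm : ∀ i, pMinus M δ p i = if i ∈ W then p i - d i ^ 2 / 17 else p i := by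
    intro i
    by_cases h : ∃ i', M.Adj i i'
    · simp [pMinus, hWdef, hd, hπdef, h]
    · simp [pMinus, hWdef, h]
  -- Move `δ² / 17` from one endpoint `a ∈ Z` of each edge to the other endpoint.
  obtain ⟨Z, hZW, hor, hpos⟩ := hS.shearerPos.exists_orientation (W := W) (π := π)
    (t := fun i => (1 + ε) * (d i ^ 2 / 17)) hπW hππ (fun i hi => (hWadj i hi).adj_sub)
    (fun i hi => by simp only [hdπ i hi]) (fun i _ => by positivity) (fun i hi => by
      have h1 := hd0 i hi
      have h2 := hd1 i hi
      have h3 := hdp i hi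
      rw [hpm, if_pos hi]
      refine mul_le_mul_of_nonneg_left ?_ (by linarith)
      nlinarith)
  set z : Fin m → ℝ := fun i => if i ∈ Z then p i - 2 * (d i ^ 2 / 17) else p i with hz
  have hzpos : ShearerPos G (fun i => (1 + ε) * z i) := by
    convert hpos using 1
    funext i
    by_cases hiZ : i ∈ Z
    · simp only [hz, if_pos hiZ, hpm, if_pos (hZW hiZ)]; ring
    · by_cases hiW : i ∈ W
      · simp only [hz, if_neg hiZ, hpm, if_pos hiW]; ring
      · simp only [hz, if_neg hiZ, hpm, if_neg hiW]
  have hz0 : ∀ i, 0 ≤ z i := fun i => by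
    have := hzpos.1 i
    exact (mul_nonneg_iff_of_pos_left (by linarith)).1 this
  have hzz : ShearerPos G z := hzpos.mono hz0 fun i => by nlinarith [hz0 i]
  have hπZ : ∀ a ∈ Z, π a ∉ Z := fun a ha => (hor a (hZW ha)).1 ha
  have hinj : Set.InjOn π Z := fun a ha b hb h => by
    rw [← hππ a (hZW ha), ← hππ b (hZW hb), h]
  have hadj : ∀ a ∈ Z, G.Adj a (π a) := fun a ha => (hWadj a (hZW ha)).adj_sub
  set θ : Fin m → ℝ := fun a => d a ^ 2 / (p a * p (π a)) with hθdef
  have hpp : ∀ a ∈ Z, 0 < p a * p (π a) := fun a ha =>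
    mul_pos ((hd0 a (hZW ha)).trans_le (hdp a (hZW ha)))
      ((hd0 a (hZW ha)).trans_le (hdp' a (hZW ha)))
  have hθeq : ∀ a ∈ Z, p a * p (π a) * θ a = d a ^ 2 := fun a ha =>
    mul_div_cancel₀ _ (hpp a ha).ne'
  have hθ0 : ∀ a ∈ Z, 0 ≤ θ a := fun a ha => div_nonneg (sq_nonneg _) (hpp a ha).le
  have hθ1 : ∀ a ∈ Z, θ a ≤ 1 := fun a ha => by
    rw [hθdef, div_le_one (hpp a ha), sq]
    exact mul_le_mul (hdp a (hZW ha)) (hdp' a (hZW ha)) (hd0 a (hZW ha)).le (hp0 a)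
  refine (R.lintegral_steps_le hA hvbl hG hp (Z := Z) (π := π) (θ := θ) (fun a ha => ?_) hθ1 hinj
    hπZ hadj).trans ((tsum_isLayered_le hzz hp0 hθ0 hθ1 hinj hadj (fun a ha => ?_)
      (fun a ha => ?_)).trans (ENNReal.ofReal_le_ofReal ?_))
  · rw [hθeq a ha]
    exact pow_le_pow_left₀ (hd0 a (hZW ha)).le (hdinter a (hZW ha)) 2
  · have h1 := hθeq a ha
    simp only [hz, if_pos ha, if_neg (hπZ a ha)]
    nlinarith [sq_nonneg (d a)]
  · simp only [hz, if_neg ha, le_refl]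
  · calc ∑ i, shearerQ G z {i} / indepPoly G Finset.univ z ≤ ∑ _i : Fin m, 1 / ε :=
          Finset.sum_le_sum fun i _ => shearerQ_singleton_div_le hε hzpos hz0 i
      _ = m / ε := by simp [div_eq_mul_inv]
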